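/- **Conventions.** A *simplicial complex* is a set with a family of finite "linked" subsets containing $\emptyset$ and all singletons and closed under taking subsets; a *map* is a mapping preserving linked subsets. $\mathbb Z$ carries the structure generated by the pairs $\{i,i+1\}$. A *loop* of a simplicial complex $S$ at $x_0$ is a map $a:\mathbb Z\to S$ with $a(i)=x_0$ for all $i\ll 0$ and all $i\gg 0$; a finite set $\Phi$ of loops is linked when $\bigcup_{a\in\Phi}\{a(i),a(i+1)\}$ is linked in $S$ for every $i$. The fundamental group $\pi_1(S,x_0)$ is the set of connected components of the resulting complex of loops (connectivity being the equivalence relation generated by "$\{a,b\}$ is linked"), with the operation induced by concatenation of loops. For a metric space $X$ and $\varepsilon\in[0,\infty]$, $t_\varepsilon X$ is the set $X$ with the finite subsets of diameter $\le\varepsilon$ as linked subsets, and $\pi_1^\varepsilon(X,x_0)=\pi_1(t_\varepsilon X,x_0)$; $X$ is $\varepsilon$-path connected if $t_\varepsilon X$ has exactly one connected component. Let $c\in\{5,6,7,8\}$, $T=[0,11]\times[0,5]$, $A=(1,4)\times(1,4)$, $B=[4,c]\times(1,2)$, $C=(c,10)\times(1,3)$, and let $X=T\setminus(A\cup B\cup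 C)\subset\mathbb R^2$ with the $\ell_\infty$-metric. For an integer $k\ge1$ and $\rho=1/k$ let $X_\rho=X\cap\rho\mathbb Z^2$. **Theorem.** Let either $Y=X$ and $0<\varepsilon\le\infty$, or $Y=X_\rho$ with $\rho=1/k$ and $\rho\le\varepsilon\le\infty$. Then $Y$ is $\varepsilon$-path connected and, for every base point $x_0\in Y$, $$\pi_1^\varepsilon(Y,x_0)\cong\begin{cases}\mathbb Z & \varepsilon<1,\\ \mathbb Z*\mathbb Z & 1\le\varepsilon<2,\\ \mathbb Z & 2\le\varepsilon<3,\\ \{*\} & 3\le\varepsilon\le\infty.\end{cases}$$ Moreover, at the base point $(0,0)\in Y$ this group is freely generated * for $\varepsilon<1$, by the class of a loop around $A\cup B\cup C$, running along the polygon $(0,0),(11,0),(11,5),(0,5),(0,0)$; * for $1\le\varepsilon<2$, by the classes of two loops, one around $A$, running along $(0,0),(4,0),(4,5),(0,5),(0,0)$, and one around $C$, running along $(0,0),(11,0),(11,5),(c,5),(c,0),(0,0)$; * for $2\le\varepsilon<3$, by the class of a loop around $A$, running along $(0,0),(4,0),(4,5),(0,5),(0,0)$. (A loop runs along a polygon if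 it passes successively through its vertices, and between two consecutive vertices it only takes values in $Y$ lying on the segment joining them.) Finally, $X_\rho$ is finite, and for $\varepsilon<\rho$ it is totally disconnected at resolution $\varepsilon$: every linked subset of $t_\varepsilon X_\rho$ has at most one point. -/

import Mathlib

open scoped ENNReal

/-- A (combinatorial) structure of simplicial complex on the set `X`: a family of finite subsets,
the linked parts, which contains the empty subset and all singletons and is closed under
taking subsets. -/
structure CSpace (X : Type*) where
  Linked : Set X → Prop
  finite_of_linked : ∀ {ξ : Set X}, Linked ξ → ξ.Finite
  linked_empty : Linked ∅
  linked_singleton : ∀ x : X, Linked {x}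
  linked_subset : ∀ {ξ η : Set X}, Linked η → ξ ⊆ η → Linked ξ

namespace CSpace

/-- Morphisms of simplicial complexes: mappings which preserve the linked parts. -/
def IsMap {X Y : Type*} (S : CSpace X) (T : CSpace Y) (f : X → Y) : Prop :=
  ∀ ξ : Set X, S.Linked ξ → T.Linked (f '' ξ)

/-- The structure induced on a subset `P` of a simplicial complex. -/
def subspace {X : Type*} (S : CSpace X) (P : Set X) : CSpace P where
  Linked ξ := S.Linked (Subtype.val '' ξ)
  finite_of_linked h := (S.finite_of_linked h).of_finite_image Subtype.val_injective.injOn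
  linked_empty := by simpa using S.linked_empty
  linked_singleton x := by simpa using S.linked_singleton x.1
  linked_subset h hs := S.linked_subset h (Set.image_mono hs)

/-- The internal hom `Y ^ X`: a finite set `Φ` of maps is linked when `Φ(ξ)`, the union of the
`f(ξ)` for `f ∈ Φ`, is linked for every linked `ξ`. -/
def hom {X Y : Type*} (S : CSpace X) (T : CSpace Y) : CSpace {f : X → Y // IsMap S T f} where
  Linked Φ := Φ.Finite ∧ ∀ ξ : Set X, S.Linked ξ → T.Linked (⋃ f ∈ Φ, f.1 '' ξ)
  finite_of_linked h := h.1
  linked_empty := ⟨Set.finite_empty, fun ξ _ => by simpa using T.linked_empty⟩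
  linked_singleton f := ⟨Set.finite_singleton f, fun ξ h => by simpa using f.2 ξ h⟩
  linked_subset h hs := ⟨h.1.subset hs, fun ξ hξ =>
    T.linked_subset (h.2 ξ hξ) (Set.biUnion_subset_biUnion_left hs)⟩

/-- The tolerance relation `x ! y` of a simplicial complex. -/
def Tol {X : Type*} (S : CSpace X) (x y : X) : Prop := S.Linked {x, y}

/-- Connectivity: the equivalence relation generated by the tolerance relation. -/
def connSetoid {X : Type*} (S : CSpace X) : Setoid X := Relation.EqvGen.setoid S.Tol

/-- The set of connected components. -/
def Pi0 {X : Type*} (S : CSpace X) : Type _ := Quotient S.connSetoid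

/-- A simplicial complex is connected if it has precisely one connected component. -/
def Connected {X : Type*} (S : CSpace X) : Prop := Nonempty S.Pi0 ∧ Subsingleton S.Pi0

/-- The integral line: the structure on `ℤ` generated by the pairs `{i, i + 1}`. -/
def line : CSpace ℤ where
  Linked ξ := ∃ i : ℤ, ξ ⊆ {i, i + 1}
  finite_of_linked := fun ⟨_, hi⟩ => (Set.toFinite _).subset hi
  linked_empty := ⟨0, Set.empty_subset _⟩
  linked_singleton i := ⟨i, by simp⟩
  linked_subset := fun ⟨i, hi⟩ hs => ⟨i, hs.trans hi⟩

/-- The lines of `X`: the maps `ℤ → X`. -/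
abbrev Line {X : Type*} (S : CSpace X) : Type _ := {a : ℤ → X // IsMap line S a}

/-- The lines which are constant at the point `x₀` on some left half-line and on some right
half-line of `ℤ`: the paths from `x₀` to `x₀`. -/
def loopSet {X : Type*} (S : CSpace X) (x₀ : X) : Set (Line S) :=
  {a | (∃ l : ℤ, ∀ i ≤ l, a.1 i = x₀) ∧ ∃ r : ℤ, ∀ i ≥ r, a.1 i = x₀}

/-- The loops of `X` at `x₀`. -/
abbrev Loop {X : Type*} (S : CSpace X) (x₀ : X) : Type _ := S.loopSet x₀

/-- The simplicial complex `Ω X` of loops at `x₀`, a subspace of the complex of lines. -/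
def loopSpace {X : Type*} (S : CSpace X) (x₀ : X) : CSpace (Loop S x₀) :=
  (hom line S).subspace (S.loopSet x₀)

/-- The (intrinsic) fundamental group: the connected components of the complex of loops. -/
def Pi1 {X : Type*} (S : CSpace X) (x₀ : X) : Type _ := (S.loopSpace x₀).Pi0

section Group

variable {X : Type*} {S : CSpace X} {x₀ : X}

lemma isMap_line_iff {a : ℤ → X} : IsMap line S a ↔ ∀ i, S.Linked {a i, a (i + 1)} := by
  constructor
  · intro h i
    have := h {i, i + 1} ⟨i, le_rfl⟩
    simpa [Set.image_pair] using this
  · rintro h ξ ⟨i, hi⟩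
    refine S.linked_subset (h i) ?_
    rintro _ ⟨j, hj, rfl⟩
    rcases hi hj with rfl | h <;> simp_all

/-- Two loops are linked iff all the quadruples `a i, a (i+1), b i, b (i+1)` are linked. -/
lemma tol_loop_iff {a b : Loop S x₀} : (S.loopSpace x₀).Tol a b ↔
    ∀ i, S.Linked {a.1.1 i, a.1.1 (i + 1), b.1.1 i, b.1.1 (i + 1)} := by
  have key : ∀ ξ : Set ℤ, (⋃ f ∈ (Subtype.val '' ({a, b} : Set (Loop S x₀)) : Set (Line S)),
      f.1 '' ξ) = a.1.1 '' ξ ∪ b.1.1 '' ξ := by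
    intro ξ
    ext x
    simp [Set.image_pair]
  constructor
  · rintro ⟨-, h⟩ i
    have := h {i, i + 1} ⟨i, le_rfl⟩
    rw [key, Set.image_pair, Set.image_pair] at this
    refine S.linked_subset this ?_
    rintro x (rfl | rfl | rfl | rfl) <;> simp
  · intro h
    refine ⟨Set.toFinite _, ?_⟩
    rintro ξ ⟨i, hi⟩
    rw [key]
    refine S.linked_subset (h i) ?_
    rintro _ (⟨j, hj, rfl⟩ | ⟨j, hj, rfl⟩) <;> rcases hi hj with rfl | h <;> simp_all

/-- The class of a loop in the fundamental group. -/
def Pi1.mk (a : Loop S x₀) : Pi1 S x₀ := Quotient.mk (S.loopSpace x₀).connSetoid a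

lemma Pi1.sound {a b : Loop S x₀}
    (h : ∀ i, S.Linked {a.1.1 i, a.1.1 (i + 1), b.1.1 i, b.1.1 (i + 1)}) :
    Pi1.mk a = Pi1.mk b :=
  Quotient.sound (Relation.EqvGen.rel _ _ (tol_loop_iff.2 h))

lemma Pi1.mk_eq_of_chain (c : ℕ → Loop S x₀)
    (h : ∀ j i, S.Linked {(c j).1.1 i, (c j).1.1 (i + 1),
      (c (j + 1)).1.1 i, (c (j + 1)).1.1 (i + 1)}) (n : ℕ) :
    Pi1.mk (c 0) = Pi1.mk (c n) := by
  induction n with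
  | zero => rfl
  | succ n ih => exact ih.trans (Pi1.sound (h n))

lemma loop_linked (a : Loop S x₀) (i : ℤ) : S.Linked {a.1.1 i, a.1.1 (i + 1)} :=
  isMap_line_iff.1 a.1.2 i

/-- A concatenation of two loops, obtained by pasting the restriction of `a` to `i ≤ m` with the
restriction of `b` to `i ≥ n`, where `a` is constant on `i ≥ m` and `b` is constant on `i ≤ n`. -/
def concat (a b : Loop S x₀) (m n : ℤ) (hm : ∀ i ≥ m, a.1.1 i = x₀)
    (hn : ∀ i ≤ n, b.1.1 i = x₀) : Loop S x₀ :=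
  ⟨⟨fun i => if i ≤ m + n then a.1.1 (i - n) else b.1.1 (i - m), by
    rw [isMap_line_iff]
    intro i
    rcases lt_trichotomy i (m + n) with h | rfl | h
    · rw [if_pos h.le, if_pos (by omega), show i + 1 - n = i - n + 1 by ring]
      exact loop_linked a _
    · have h := loop_linked b n
      rw [hn n le_rfl] at h
      rwa [if_pos le_rfl, if_neg (by omega), hm _ (by omega),
        show m + n + 1 - m = n + 1 by ring]
    · rw [if_neg (by omega), if_neg (by omega), show i + 1 - m = i - m + 1 by ring]
      exact loop_linked b _⟩, by
    obtain ⟨⟨l, hl⟩, -⟩ := a.2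
    obtain ⟨-, ⟨r, hr⟩⟩ := b.2
    refine ⟨⟨min (l + n) (m + n), fun i hi => ?_⟩, ⟨max (r + m) (m + n + 1), fun i hi => ?_⟩⟩
    · have h1 := hi.trans (min_le_left _ _)
      have h2 := hi.trans (min_le_right _ _)
      simp only [if_pos h2]
      exact hl _ (by omega)
    · have h1 := (le_max_left _ _).trans hi
      have h2 := (le_max_right _ _).trans hi
      simp only [if_neg (show ¬ i ≤ m + n by omega)]
      exact hr _ (by omega)⟩

/-- The loop `a` with the elementary delay at `t`. -/
def delay (a : Loop S x₀) (t : ℤ) : Loop S x₀ :=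
  ⟨⟨fun i => if i ≤ t then a.1.1 i else a.1.1 (i - 1), by
    rw [isMap_line_iff]
    intro i
    rcases lt_trichotomy i t with h | rfl | h
    · rw [if_pos h.le, if_pos (by omega)]
      exact loop_linked a _
    · rw [if_pos le_rfl, if_neg (by omega), add_sub_cancel_right, Set.pair_eq_singleton]
      exact S.linked_singleton _
    · rw [if_neg (by omega), if_neg (by omega), show i + 1 - 1 = i - 1 + 1 by ring]
      exact loop_linked a _⟩, by
    obtain ⟨⟨l, hl⟩, ⟨r, hr⟩⟩ := a.2
    refine ⟨⟨l, fun i hi => ?_⟩, ⟨r + 1, fun i hi => ?_⟩⟩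
    · dsimp only
      split_ifs
      exacts [hl _ hi, hl _ (by omega)]
    · dsimp only
      split_ifs
      exacts [hr _ (by omega), hr _ (by omega)]⟩

lemma loop_ext {a b : Loop S x₀} (h : ∀ i, a.1.1 i = b.1.1 i) : a = b :=
  Subtype.ext (Subtype.ext (funext h))

lemma Pi1.mk_delay (a : Loop S x₀) (t : ℤ) : Pi1.mk (delay a t) = Pi1.mk a := by
  obtain ⟨-, ⟨r, hr⟩⟩ := a.2
  have h := Pi1.mk_eq_of_chain (fun j : ℕ => delay a (t + j)) (fun j i => ?_) (r - t).toNat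
  · simp only [Nat.cast_zero, add_zero] at h
    rw [h]
    congr 1
    refine loop_ext fun i => ?_
    simp only [delay]
    split_ifs with hi
    · rfl
    · rw [hr _ (by omega), hr _ (by omega)]
  · simp only [delay]
    push_cast
    rcases lt_trichotomy i (t + j) with h | h | h
    · rw [if_pos (by omega), if_pos (by omega), if_pos (by omega), if_pos (by omega)]
      simpa [Set.insert_comm] using loop_linked a i
    · rw [if_pos (by omega), if_neg (by omega), if_pos (by omega), if_pos (by omega)]
      simpa using loop_linked a i
    · rcases eq_or_lt_of_le (show t + j + 1 ≤ i by omega) with h' | h'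
      · rw [if_neg (by omega), if_neg (by omega), if_pos (by omega), if_neg (by omega)]
        have := loop_linked a (i - 1)
        simp only [sub_add_cancel] at this
        simpa using this
      · rw [if_neg (by omega), if_neg (by omega), if_neg (by omega), if_neg (by omega)]
        have := loop_linked a (i - 1)
        simp only [sub_add_cancel] at this
        simpa [Set.insert_comm] using this

/-- Translation of a loop by one unit. -/
def shift (a : Loop S x₀) : Loop S x₀ :=
  ⟨⟨fun i => a.1.1 (i + 1), isMap_line_iff.2 fun i => loop_linked a (i + 1)⟩, by
    obtain ⟨⟨l, hl⟩, ⟨r, hr⟩⟩ := a.2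
    exact ⟨⟨l - 1, fun i hi => hl _ (by omega)⟩, ⟨r, fun i hi => hr _ (by omega)⟩⟩⟩

lemma Pi1.mk_shift (a : Loop S x₀) : Pi1.mk (shift a) = Pi1.mk a := by
  obtain ⟨⟨l, hl⟩, -⟩ := a.2
  rw [← Pi1.mk_delay (shift a) (l - 1)]
  congr 1
  refine loop_ext fun i => ?_
  simp only [delay, shift]
  split_ifs with hi
  · rw [hl _ (by omega), hl _ (by omega)]
  · rw [sub_add_cancel]

lemma Pi1.mk_concat_succ_left (a b : Loop S x₀) (m n : ℤ) (hm hn) (hm') :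
    Pi1.mk (concat a b (m + 1) n hm' hn) = Pi1.mk (concat a b m n hm hn) := by
  rw [← Pi1.mk_delay (concat a b m n hm hn) (m + n)]
  congr 1
  refine loop_ext fun i => ?_
  simp only [delay, concat]
  rcases lt_trichotomy i (m + n + 1) with h | h | h
  · rw [if_pos (by omega), if_pos (by omega), if_pos (by omega)]
  · rw [if_pos (by omega), if_neg (by omega), if_pos (by omega), hm _ (by omega), hm _ (by omega)]
  · rw [if_neg (by omega), if_neg (by omega), if_neg (by omega), sub_sub, add_comm 1 m]

lemma Pi1.mk_concat_pred_right (a b : Loop S x₀) (m n : ℤ) (hm hn) (hn') :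
    Pi1.mk (concat a b m (n - 1) hm hn') = Pi1.mk (concat a b m n hm hn) := by
  rw [← Pi1.mk_delay (concat a b m n hm hn) (m + n), ← Pi1.mk_shift (delay _ _)]
  congr 1
  refine loop_ext fun i => ?_
  simp only [delay, concat, shift]
  rcases lt_trichotomy i (m + n) with h | h | h
  · rw [if_pos (by omega), if_pos (by omega), if_pos (by omega)]
    exact congrArg _ (by ring)
  · rw [if_neg (by omega), if_neg (by omega), if_pos (by omega), hn _ (by omega), hm _ (by omega)]
  · rw [if_neg (by omega), if_neg (by omega), if_neg (by omega)]
    exact congrArg _ (by ring)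

/-- The class of a concatenation does not depend on the choice of the supports. -/
lemma Pi1.mk_concat_eq (a b : Loop S x₀) (m n m' n' : ℤ) (hm hn) (hm' hn') :
    Pi1.mk (concat a b m n hm hn) = Pi1.mk (concat a b m' n' hm' hn') := by
  have left : ∀ (k : ℕ) (m n : ℤ) (hm hn) (hmk),
      Pi1.mk (concat a b (m + k) n hmk hn) = Pi1.mk (concat a b m n hm hn) := by
    intro k m n hm hn
    induction k with
    | zero => intro hmk; congr! 2; simp
    | succ k ih =>
      intro hmk
      have h1 : ∀ i ≥ m + k, a.1.1 i = x₀ := fun i hi => hm i (by omega)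
      rw [← ih h1, ← Pi1.mk_concat_succ_left a b (m + k) n h1 hn (fun i hi => hm i (by omega))]
      congr! 2
      push_cast; ring
  have right : ∀ (k : ℕ) (m n : ℤ) (hm hn) (hnk),
      Pi1.mk (concat a b m (n - k) hm hnk) = Pi1.mk (concat a b m n hm hn) := by
    intro k m n hm hn
    induction k with
    | zero => intro hnk; congr! 2; simp
    | succ k ih =>
      intro hnk
      have h1 : ∀ i ≤ n - k, b.1.1 i = x₀ := fun i hi => hn i (by omega)
      rw [← ih h1, ← Pi1.mk_concat_pred_right a b m (n - k) hm h1 (fun i hi => hn i (by omega))]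
      congr! 2
      push_cast; ring
  have e1 : ∀ (m n M N : ℤ) (hm hn hM hN), m ≤ M → N ≤ n →
      Pi1.mk (concat a b m n hm hn) = Pi1.mk (concat a b M N hM hN) := by
    intro m n M N hm hn hM hN h1 h2
    obtain ⟨k, rfl⟩ : ∃ k : ℕ, M = m + k := ⟨(M - m).toNat, by omega⟩
    obtain ⟨q, rfl⟩ : ∃ q : ℕ, N = n - q := ⟨(n - N).toNat, by omega⟩
    rw [right q (m + k) n hM hn hN, left k m n hm hn hM]
  have hM : ∀ i ≥ max m m', a.1.1 i = x₀ := fun i hi => hm i ((le_max_left _ _).trans hi)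
  have hN : ∀ i ≤ min n n', b.1.1 i = x₀ := fun i hi => hn i (hi.trans (min_le_left _ _))
  rw [e1 m n _ _ hm hn hM hN (le_max_left _ _) (min_le_left _ _),
    e1 m' n' _ _ hm' hn' hM hN (le_max_right _ _) (min_le_right _ _)]

/-- A concatenation of two loops, for some choice of the supports. -/
noncomputable def Loop.comp (a b : Loop S x₀) : Loop S x₀ :=
  concat a b a.2.2.choose b.2.1.choose a.2.2.choose_spec b.2.1.choose_spec

lemma Pi1.mk_comp (a b : Loop S x₀) (m n : ℤ) (hm hn) :
    Pi1.mk (Loop.comp a b) = Pi1.mk (concat a b m n hm hn) :=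
  Pi1.mk_concat_eq ..

/-- The reversed loop. -/
def Loop.reverse (a : Loop S x₀) : Loop S x₀ :=
  ⟨⟨fun i => a.1.1 (-i), isMap_line_iff.2 fun i => by
    have := loop_linked a (-i - 1)
    rw [sub_add_cancel, Set.pair_comm] at this
    rwa [show -(i + 1) = -i - 1 by ring]⟩, by
    obtain ⟨⟨l, hl⟩, ⟨r, hr⟩⟩ := a.2
    exact ⟨⟨-r, fun i hi => hr _ (by omega)⟩, ⟨-l, fun i hi => hl _ (by omega)⟩⟩⟩

/-- The constant loop. -/
def Loop.const (S : CSpace X) (x₀ : X) : Loop S x₀ :=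
  ⟨⟨fun _ => x₀, isMap_line_iff.2 fun _ => by simpa using S.linked_singleton x₀⟩,
    ⟨0, fun _ _ => rfl⟩, ⟨0, fun _ _ => rfl⟩⟩

lemma Pi1.comp_congr_left {a a' : Loop S x₀} (b : Loop S x₀)
    (h : Relation.EqvGen (S.loopSpace x₀).Tol a a') :
    Pi1.mk (Loop.comp a b) = Pi1.mk (Loop.comp a' b) := by
  induction h with
  | refl => rfl
  | symm _ _ _ ih => exact ih.symm
  | trans _ _ _ _ _ ih1 ih2 => exact ih1.trans ih2
  | rel a a' h =>
    obtain ⟨-, ⟨r, hr⟩⟩ := a.2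
    obtain ⟨-, ⟨r', hr'⟩⟩ := a'.2
    obtain ⟨⟨n, hn⟩, -⟩ := b.2
    have hm : ∀ i ≥ max r r', a.1.1 i = x₀ := fun i hi => hr i ((le_max_left _ _).trans hi)
    have hm' : ∀ i ≥ max r r', a'.1.1 i = x₀ := fun i hi => hr' i ((le_max_right _ _).trans hi)
    rw [Pi1.mk_comp a b _ n hm hn, Pi1.mk_comp a' b _ n hm' hn]
    generalize max r r' = m at hm hm'
    refine Pi1.sound fun i => ?_
    simp only [concat]
    have h := tol_loop_iff.1 h
    rcases lt_trichotomy i (m + n) with h1 | h1 | h1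
    · rw [if_pos (by omega), if_pos (by omega), if_pos (by omega), if_pos (by omega),
        show i + 1 - n = i - n + 1 by ring]
      exact h _
    · rw [if_pos (by omega), if_neg (by omega), if_pos (by omega), if_neg (by omega),
        hm _ (by omega), hm' _ (by omega), show i + 1 - m = n + 1 by omega]
      have h2 := loop_linked b n
      rw [hn n le_rfl] at h2
      simpa [Set.insert_comm] using h2
    · rw [if_neg (by omega), if_neg (by omega), if_neg (by omega), if_neg (by omega),
        show i + 1 - m = i - m + 1 by ring]
      simpa [Set.insert_comm] using loop_linked b (i - m)

lemma Pi1.comp_congr_right (a : Loop S x₀) {b b' : Loop S x₀}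
    (h : Relation.EqvGen (S.loopSpace x₀).Tol b b') :
    Pi1.mk (Loop.comp a b) = Pi1.mk (Loop.comp a b') := by
  induction h with
  | refl => rfl
  | symm _ _ _ ih => exact ih.symm
  | trans _ _ _ _ _ ih1 ih2 => exact ih1.trans ih2
  | rel b b' h =>
    obtain ⟨⟨l, hl⟩, -⟩ := b.2
    obtain ⟨⟨l', hl'⟩, -⟩ := b'.2
    obtain ⟨-, ⟨m, hm⟩⟩ := a.2
    have hn : ∀ i ≤ min l l', b.1.1 i = x₀ := fun i hi => hl i (hi.trans (min_le_left _ _))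
    have hn' : ∀ i ≤ min l l', b'.1.1 i = x₀ := fun i hi => hl' i (hi.trans (min_le_right _ _))
    rw [Pi1.mk_comp a b m _ hm hn, Pi1.mk_comp a b' m _ hm hn']
    generalize min l l' = n at hn hn'
    refine Pi1.sound fun i => ?_
    simp only [concat]
    have h := tol_loop_iff.1 h
    rcases lt_trichotomy i (m + n) with h1 | h1 | h1
    · rw [if_pos (by omega), if_pos (by omega), if_pos (by omega), if_pos (by omega),
        show i + 1 - n = i - n + 1 by ring]
      simpa [Set.insert_comm] using loop_linked a (i - n)
    · have := h n
      rw [hn n le_rfl, hn' n le_rfl] at this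
      rw [if_pos (by omega), if_neg (by omega), if_pos (by omega), if_neg (by omega),
        hm _ (by omega), show i + 1 - m = n + 1 by omega]
      exact this
    · rw [if_neg (by omega), if_neg (by omega), if_neg (by omega), if_neg (by omega),
        show i + 1 - m = i - m + 1 by ring]
      exact h _

lemma Pi1.reverse_congr {a a' : Loop S x₀} (h : Relation.EqvGen (S.loopSpace x₀).Tol a a') :
    Pi1.mk (Loop.reverse a) = Pi1.mk (Loop.reverse a') := by
  induction h with
  | refl => rfl
  | symm _ _ _ ih => exact ih.symm
  | trans _ _ _ _ _ ih1 ih2 => exact ih1.trans ih2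
  | rel a a' h =>
    refine Pi1.sound fun i => ?_
    have h := tol_loop_iff.1 h (-i - 1)
    rw [sub_add_cancel] at h
    simp only [Loop.reverse, show -(i + 1) = -i - 1 by ring]
    refine S.linked_subset h ?_
    rintro x (rfl | rfl | rfl | rfl) <;> simp

lemma Pi1.assoc_aux (a b c : Loop S x₀) :
    Pi1.mk (Loop.comp (Loop.comp a b) c) = Pi1.mk (Loop.comp a (Loop.comp b c)) := by
  obtain ⟨-, ⟨m, hm⟩⟩ := a.2
  obtain ⟨⟨n₀, hn₀⟩, ⟨q₀, hq₀⟩⟩ := b.2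
  obtain ⟨⟨p, hp⟩, -⟩ := c.2
  obtain ⟨n, q, hnq, hn, hq⟩ : ∃ n q : ℤ, n ≤ q ∧ (∀ i ≤ n, b.1.1 i = x₀) ∧
      ∀ i ≥ q, b.1.1 i = x₀ :=
    ⟨n₀, max n₀ q₀, le_max_left _ _, hn₀, fun i hi => hq₀ i ((le_max_right _ _).trans hi)⟩
  have hd : ∀ i ≥ m + q, (concat a b m n hm hn).1.1 i = x₀ := by
    intro i hi
    simp only [concat]
    split_ifs
    exacts [hm _ (by omega), hq _ (by omega)]
  have he : ∀ i ≤ n + p, (concat b c q p hq hp).1.1 i = x₀ := by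
    intro i hi
    simp only [concat]
    split_ifs
    exacts [hn _ (by omega), hp _ (by omega)]
  have e1 : Pi1.mk (Loop.comp (Loop.comp a b) c) =
      Pi1.mk (Loop.comp (concat a b m n hm hn) c) :=
    Pi1.comp_congr_left c (Quotient.exact (Pi1.mk_comp a b m n hm hn))
  have e2 : Pi1.mk (Loop.comp a (Loop.comp b c)) =
      Pi1.mk (Loop.comp a (concat b c q p hq hp)) :=
    Pi1.comp_congr_right a (Quotient.exact (Pi1.mk_comp b c q p hq hp))
  rw [e1, e2, Pi1.mk_comp _ c (m + q) p hd hp, Pi1.mk_comp a _ m (n + p) hm he]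
  congr 1
  refine loop_ext fun i => ?_
  simp only [concat]
  by_cases h1 : i ≤ m + n + p
  · rw [if_pos (by omega), if_pos (by omega), if_pos (by omega)]
    exact congrArg _ (by ring)
  · by_cases h2 : i ≤ m + q + p
    · rw [if_pos (by omega), if_neg (by omega), if_neg (by omega), if_pos (by omega)]
      exact congrArg _ (by ring)
    · rw [if_neg (by omega), if_neg (by omega), if_neg (by omega)]
      exact congrArg _ (by ring)

lemma Pi1.const_comp (a : Loop S x₀) :
    Pi1.mk (Loop.comp (Loop.const S x₀) a) = Pi1.mk a := by
  obtain ⟨⟨l, hl⟩, -⟩ := a.2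
  rw [Pi1.mk_comp _ a 0 l (fun _ _ => rfl) hl]
  congr 1
  refine loop_ext fun i => ?_
  simp only [concat, Loop.const]
  split_ifs
  · exact (hl _ (by omega)).symm
  · rw [sub_zero]

lemma Pi1.comp_const (a : Loop S x₀) :
    Pi1.mk (Loop.comp a (Loop.const S x₀)) = Pi1.mk a := by
  obtain ⟨-, ⟨r, hr⟩⟩ := a.2
  rw [Pi1.mk_comp a _ r 0 hr (fun _ _ => rfl)]
  congr 1
  refine loop_ext fun i => ?_
  simp only [concat, Loop.const]
  split_ifs
  · rw [sub_zero]
  · exact (hr _ (by omega)).symm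

lemma Pi1.reverse_comp (a : Loop S x₀) :
    Pi1.mk (Loop.comp (Loop.reverse a) a) = Pi1.mk (Loop.const S x₀) := by
  obtain ⟨⟨l, hl⟩, ⟨r, hr⟩⟩ := a.2
  have hm : ∀ i ≥ -l, (Loop.reverse a).1.1 i = x₀ := fun i hi => hl _ (by omega)
  rw [Pi1.mk_comp _ a (-l) l hm hl]
  have hmap : ∀ j i : ℤ, S.Linked {a.1.1 (l + max (max i (-i)) j),
      a.1.1 (l + max (max (i + 1) (-(i + 1))) j), a.1.1 (l + max (max i (-i)) (j + 1)),
      a.1.1 (l + max (max (i + 1) (-(i + 1))) (j + 1))} := by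
    intro j i
    obtain ⟨k, hk⟩ : ∃ k : ℤ, k = max (min (max i (-i)) (max (i + 1) (-(i + 1)))) j := ⟨_, rfl⟩
    refine S.linked_subset (loop_linked a (l + k)) ?_
    have e : ∀ u : ℤ, u = k ∨ u = k + 1 → a.1.1 (l + u) ∈
        ({a.1.1 (l + k), a.1.1 (l + k + 1)} : Set X) := by
      rintro u (rfl | rfl)
      · simp
      · simp [add_assoc]
    rintro x (rfl | rfl | rfl | rfl) <;> apply e <;> omega
  have hmap' : ∀ j i : ℤ, S.Linked {a.1.1 (l + max (max i (-i)) j),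
      a.1.1 (l + max (max (i + 1) (-(i + 1))) j)} :=
    fun j i => S.linked_subset (hmap j i) (by
      rintro x (rfl | rfl) <;> simp)
  let c : ℕ → Loop S x₀ := fun j => ⟨⟨fun i => a.1.1 (l + max (max i (-i)) j),
    isMap_line_iff.2 (hmap' j)⟩,
    ⟨l - r, fun i hi => hr _ (by omega)⟩, ⟨r - l, fun i hi => hr _ (by omega)⟩⟩
  have h := Pi1.mk_eq_of_chain c (fun j i => by
    simpa only [c, Nat.cast_add, Nat.cast_one] using hmap j i) (r - l).toNat
  convert h using 2
  · refine loop_ext fun i => ?_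
    simp only [concat, Loop.reverse, c]
    split_ifs with hi
    · exact congrArg _ (by push_cast; omega)
    · exact congrArg _ (by push_cast; omega)
  · refine loop_ext fun i => ?_
    simp only [Loop.const, c]
    exact (hr _ (by omega)).symm

/-- The product of the fundamental group, induced by the concatenation of loops. -/
noncomputable instance : Mul (Pi1 S x₀) :=
  ⟨Quotient.lift₂ (fun a b => Pi1.mk (Loop.comp a b)) fun _ b a' _ h₁ h₂ =>
    (Pi1.comp_congr_left b h₁).trans (Pi1.comp_congr_right a' h₂)⟩

instance : Inv (Pi1 S x₀) :=
  ⟨Quotient.lift (fun a => Pi1.mk (Loop.reverse a)) fun _ _ h => Pi1.reverse_congr h⟩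

instance : One (Pi1 S x₀) := ⟨Pi1.mk (Loop.const S x₀)⟩

noncomputable instance : Group (Pi1 S x₀) :=
  Group.ofLeftAxioms
    (by
      rintro ⟨a⟩ ⟨b⟩ ⟨c⟩
      exact Pi1.assoc_aux a b c)
    (by
      rintro ⟨a⟩
      exact Pi1.const_comp a)
    (by
      rintro ⟨a⟩
      exact Pi1.reverse_comp a)

/-- The product of two classes of loops is the class of any admissible concatenation. -/
lemma Pi1.mk_mul_mk (a b : Loop S x₀) (m n : ℤ) (hm hn) :
    Pi1.mk a * Pi1.mk b = Pi1.mk (concat a b m n hm hn) :=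
  Pi1.mk_comp a b m n hm hn

end Group

end CSpace

/-- The structure `t_ε X` of a metric space at resolution `ε ∈ [0, ∞]`: a finite subset is linked
iff its diameter is at most `ε`. -/
def CSpace.resolution (X : Type*) [PseudoEMetricSpace X] (ε : ℝ≥0∞) : CSpace X where
  Linked ξ := ξ.Finite ∧ Metric.ediam ξ ≤ ε
  finite_of_linked h := h.1
  linked_empty := ⟨Set.finite_empty, by simp⟩
  linked_singleton x := ⟨Set.finite_singleton x, by simp⟩
  linked_subset h hs := ⟨h.1.subset hs, (Metric.ediam_mono hs).trans h.2⟩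

/-- The region `T \ (A ∪ B ∪ C)` of the plane, where `T = [0, 11] × [0, 5]`,
`A = (1, 4) × (1, 4)`, `B = [4, c] × (1, 2)` and `C = (c, 10) × (1, 3)`. As a subset of `ℝ × ℝ`,
it carries the `l_∞`-metric. -/
def planarRegion (c : ℝ) : Set (ℝ × ℝ) :=
  (Set.Icc 0 11 ×ˢ Set.Icc 0 5) \
    (Set.Ioo 1 4 ×ˢ Set.Ioo 1 4 ∪ Set.Icc 4 c ×ˢ Set.Ioo 1 2 ∪ Set.Ioo c 10 ×ˢ Set.Ioo 1 3)

/-- The trace of a region of the plane on the lattice `ρℤ × ρℤ`, for `ρ = 1 / k`. -/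
def digitalModel (X : Set (ℝ × ℝ)) (k : ℕ) : Set (ℝ × ℝ) :=
  X ∩ {p | ∃ i j : ℤ, p = ((i : ℝ) / k, (j : ℝ) / k)}

/-- The sequence `a` of points of the plane runs along the polygonal line with successive vertices
`P 0, …, P n`: it is constant at `P 0` before some instant `t 0`, constant at `P n` after some
instant `t n`, and between the instants `t k` and `t (k + 1)` it goes from `P k` to `P (k + 1)`
through points of the segment with these end points. -/
def RunsAlong (a : ℤ → ℝ × ℝ) {n : ℕ} (P : Fin (n + 1) → ℝ × ℝ) : Prop :=
  ∃ t : Fin (n + 1) → ℤ, Monotone t ∧ (∀ i ≤ t 0, a i = P 0) ∧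
    (∀ i ≥ t (Fin.last n), a i = P (Fin.last n)) ∧ (∀ k, a (t k) = P k) ∧
    ∀ (k : Fin n) (i : ℤ), t k.castSucc ≤ i → i ≤ t k.succ →
      a i ∈ segment ℝ (P k.castSucc) (P k.succ)

/-! Cut the region into vertical columns. The column of abscissa `s` consists of a lower segment `0
≤ y ≤ 1` and an upper segment `τ s ≤ y ≤ 5`, and a step of size `ε` crosses the gap exactly when `τ
s ≤ 1 + ε`; call such a column passable. The lower strip and the upper part carry no holonomy of
their own, and they are joined only through the passable columns. As in the theorem of van Kampen,
the fundamental group is therefore free, with one generator fewer than there are components of the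
set of passable abscissas. These components are `[0, 1]` and `[10, 11]` for `ε < 1`; `[0, 1]`, `[4,
c]` and `[10, 11]` for `1 ≤ ε < 2`; `[0, 1]` and `[4, 11]` for `2 ≤ ε < 3`; and all of `[0, 11]`
from `ε = 3` on.

The computation is done with nonabelian cocycles. A function on edges with values in a group,
multiplicative on linked triangles, has a holonomy along loops and so defines a homomorphism on
`Pi1` (`IsCocycle.toHom`). Joining each point to the base point by a path yields a universal cocycle
with values in `Pi1` itself. Consequently a cocycle from which all others are obtained, by a
homomorphism followed by a gauge transformation, has an injective homomorphism
(`IsCocycle.toHom_injective`).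

All cocycles on the region are determined by `PlaneCocycle.exists_gauge`: a cocycle has a potential
on the lower part and one on the upper part, and it is encoded by the discrepancy `κ` of the two,
which is locally constant on passable columns. Choosing `κ` with values in a free group gives a
universal example, and explicit polygonal loops whose holonomies are the generators give
surjectivity and the free bases (`HasRun`, `FreeGroup.lift_bijective_of_injective`). -/

namespace CSpace

/-! ### Cocycles, holonomy, and the induced homomorphism on the fundamental group. -/

section Cocycle

variable {X G : Type*} [Group G] {S : CSpace X} {x₀ : X}

/-- A `G`-valued `1`-cocycle on a simplicial complex: a multiplicative function on the edges. -/
def IsCocycle (S : CSpace X) (w : X → X → G) : Prop :=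
  ∀ x y z, S.Linked {x, y, z} → w x y * w y z = w x z

/-- The product of the values of `w` on `n` successive edges of the sequence `a`, from the
instant `l` on. -/
def hol (w : X → X → G) (a : ℤ → X) (l : ℤ) : ℕ → G
  | 0 => 1
  | n + 1 => hol w a l n * w (a (l + n)) (a (l + n + 1))

lemma IsCocycle.self {w : X → X → G} (hw : IsCocycle S w) (x : X) : w x x = 1 := by
  have := hw x x x (by simpa using S.linked_singleton x)
  simpa using this

lemma IsCocycle.mul_symm {w : X → X → G} (hw : IsCocycle S w) {x y : X}
    (h : S.Linked {x, y}) : w x y * w y x = 1 := by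
  rw [hw x y x (S.linked_subset h (by rintro z (rfl | rfl | rfl) <;> simp)), hw.self]

lemma hol_add (w : X → X → G) (a : ℤ → X) (l : ℤ) (m n : ℕ) :
    hol w a l (m + n) = hol w a l m * hol w a (l + m) n := by
  induction n with
  | zero => simp [hol]
  | succ n ih =>
    rw [← add_assoc, hol, ih, hol, mul_assoc]
    push_cast
    simp only [add_assoc]

lemma hol_congr {w : X → X → G} {a b : ℤ → X} {l l' : ℤ} (n : ℕ)
    (h : ∀ j : ℤ, 0 ≤ j → j ≤ n → a (l + j) = b (l' + j)) : hol w a l n = hol w b l' n := by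
  induction n with
  | zero => rfl
  | succ n ih =>
    rw [hol, hol, ih fun j h0 h1 => h j h0 (by push_cast; omega), add_assoc, add_assoc,
      h n (by omega) (by push_cast; omega), h (n + 1) (by omega) (by push_cast; omega)]

/-- The holonomy of a coboundary only depends on the end points. -/
lemma hol_telescope {w : X → X → G} {a : ℤ → X} {l : ℤ} (m : X → G) (n : ℕ)
    (h : ∀ i, w (a i) (a (i + 1)) = (m (a i))⁻¹ * m (a (i + 1))) :
    hol w a l n = (m (a l))⁻¹ * m (a (l + n)) := by
  induction n with
  | zero => simp [hol]
  | succ n ih =>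
    rw [hol, ih, h]
    push_cast
    group

/-- The gauge factors at the intermediate points cancel in pairs. On a closed path what remains is a
conjugation. -/
lemma hol_gauge {H : Type*} [Group H] {w : X → X → G} {E : X → X → H} (θ : G →* H) (f : X → H)
    {a : ℤ → X} (h : ∀ i, E (a i) (a (i + 1)) = (f (a i))⁻¹ * θ (w (a i) (a (i + 1))) *
      f (a (i + 1))) (l : ℤ) (n : ℕ) :
    hol E a l n = (f (a l))⁻¹ * θ (hol w a l n) * f (a (l + n)) := by
  induction n with
  | zero => simp [hol]
  | succ n ih =>
    rw [hol, ih, h, hol, map_mul]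
    push_cast
    simp only [add_assoc]
    group

lemma hol_eq_one {w : X → X → G} (hw : IsCocycle S w) {a : ℤ → X} {l : ℤ} {n : ℕ} (x : X)
    (h : ∀ j : ℤ, 0 ≤ j → j ≤ n → a (l + j) = x) : hol w a l n = 1 := by
  rw [hol_congr (b := fun _ => x) (l' := l) n h,
    hol_telescope (fun _ => 1) n fun i => by rw [hw.self]; simp]
  simp

/-- The reversal `i ↦ 1 - i` is the one that occurs in the returning half of `glue`: it visits `q 0,
q (-1), …` from the instant `1` on. -/
lemma hol_reverse {w : X → X → G} (hw : IsCocycle S w) {q : ℤ → X}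
    (hq : ∀ i, S.Linked {q i, q (i + 1)}) (n : ℕ) :
    hol w (fun i => q (1 - i)) 1 n = (hol w q (-n) n)⁻¹ := by
  rw [eq_inv_iff_mul_eq_one]
  induction n with
  | zero => simp [hol]
  | succ n ih =>
    have h1 := hol_add w q (-((n + 1 : ℕ) : ℤ)) 1 n
    rw [add_comm 1 n, show -((n + 1 : ℕ) : ℤ) + ((1 : ℕ) : ℤ) = -n by push_cast; ring] at h1
    rw [h1, hol, hol, hol]
    have h2 := hw.mul_symm (S.linked_subset (hq (-n - 1)) (Set.pair_comm _ _).le)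
    rw [sub_add_cancel] at h2
    simp only [one_mul]
    rw [show (1 : ℤ) - (1 + n) = -n by ring, show (1 : ℤ) - (1 + n + 1) = -n - 1 by ring,
      show -((n + 1 : ℕ) : ℤ) + ((0 : ℕ) : ℤ) = -n - 1 by push_cast; ring,
      sub_add_cancel, mul_assoc, ← mul_assoc (w _ _), h2, one_mul]
    exact ih

/-- Constant stretches contribute `w x x = 1`, so both windows can be padded to a common one. -/
lemma hol_eq_of_const {w : X → X → G} (hw : IsCocycle S w) {a : ℤ → X} {x y : X} {l l' : ℤ}
    {n n' : ℕ} (h1 : ∀ i ≤ l, a i = x) (h2 : ∀ i ≥ l + n, a i = y) (h1' : ∀ i ≤ l', a i = x)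
    (h2' : ∀ i ≥ l' + n', a i = y) : hol w a l n = hol w a l' n' := by
  have key : ∀ (l : ℤ) (n d e : ℕ), (∀ i ≤ l, a i = x) → (∀ i ≥ l + n, a i = y) →
      hol w a (l - d) (d + (n + e)) = hol w a l n := by
    intro l n d e h1 h2
    rw [hol_add, hol_add, hol_eq_one hw x fun j _ _ => h1 _ (by omega), one_mul,
      hol_eq_one hw y (n := e) fun j _ _ => h2 _ (by omega), mul_one]
    congr 1
    ring
  obtain ⟨d, d', h⟩ : ∃ d d' : ℕ, l - d = l' - d' :=
    ⟨(l - min l l').toNat, (l' - min l l').toNat, by omega⟩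
  obtain ⟨e, e', h'⟩ : ∃ e e' : ℕ, d + (n + e) = d' + (n' + e') := ⟨d' + n', d + n, by omega⟩
  rw [← key l n d e h1 h2, ← key l' n' d' e' h1' h2', h, h']

/-- The holonomy of a loop. -/
noncomputable def Loop.hol (w : X → X → G) (a : Loop S x₀) : G :=
  CSpace.hol w a.1.1 a.2.1.choose (a.2.2.choose - a.2.1.choose).toNat

lemma Loop.hol_eq {w : X → X → G} (hw : IsCocycle S w) (a : Loop S x₀) {l : ℤ} {n : ℕ}
    (h1 : ∀ i ≤ l, a.1.1 i = x₀) (h2 : ∀ i ≥ l + n, a.1.1 i = x₀) :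
    Loop.hol w a = CSpace.hol w a.1.1 l n :=
  hol_eq_of_const hw a.2.1.choose_spec (fun i hi => a.2.2.choose_spec i (by omega)) h1 h2

lemma Loop.exists_const (a : Loop S x₀) :
    ∃ (l : ℤ) (n : ℕ), (∀ i ≤ l, a.1.1 i = x₀) ∧ ∀ i ≥ l + n, a.1.1 i = x₀ := by
  obtain ⟨⟨l, hl⟩, ⟨r, hr⟩⟩ := a.2
  exact ⟨l, (r - l).toNat, hl, fun i hi => hr i (by omega)⟩

lemma Loop.hol_congr {w : X → X → G} (hw : IsCocycle S w) {a b : Loop S x₀}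
    (h : Relation.EqvGen (S.loopSpace x₀).Tol a b) : Loop.hol w a = Loop.hol w b := by
  induction h with
  | refl => rfl
  | symm _ _ _ ih => exact ih.symm
  | trans _ _ _ _ _ ih1 ih2 => exact ih1.trans ih2
  | rel a b h =>
    have h := tol_loop_iff.1 h
    obtain ⟨l, n, h1, h2⟩ := a.exists_const
    obtain ⟨l', n', h1', h2'⟩ := b.exists_const
    obtain ⟨m, N, ha, hb, hm, hm'⟩ : ∃ (m : ℤ) (N : ℕ), (∀ i ≤ m, a.1.1 i = x₀) ∧
        (∀ i ≤ m, b.1.1 i = x₀) ∧ (∀ i ≥ m + N, a.1.1 i = x₀) ∧ ∀ i ≥ m + N, b.1.1 i = x₀ :=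
      ⟨min l l', (max (l + n) (l' + n') - min l l').toNat, fun i _ => h1 i (by omega),
        fun i _ => h1' i (by omega), fun i _ => h2 i (by omega), fun i _ => h2' i (by omega)⟩
    rw [Loop.hol_eq hw a ha hm, Loop.hol_eq hw b hb hm']
    -- A ladder argument: follow `a` for `k` steps, then cross the rung to `b`. Each further square
    -- has its four vertices linked, and splits into two triangles on which `w` is multiplicative.
    have key : ∀ k : ℕ, CSpace.hol w a.1.1 m k * w (a.1.1 (m + k)) (b.1.1 (m + k)) =
        CSpace.hol w b.1.1 m k := by
      intro k
      induction k with
      | zero => simp [CSpace.hol, ha, hb, hw.self]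
      | succ k ih =>
        push_cast
        rw [CSpace.hol, CSpace.hol, ← ih, ← add_assoc, mul_assoc, mul_assoc,
          hw _ _ _ (S.linked_subset (h (m + k)) ?_), hw _ _ _ (S.linked_subset (h (m + k)) ?_)]
        · rintro x (rfl | rfl | rfl) <;> simp
        · rintro x (rfl | rfl | rfl) <;> simp
    rw [← key N, hm _ le_rfl, hm' _ le_rfl, hw.self, mul_one]

/-- The homomorphism from the fundamental group which is defined by a cocycle. -/
noncomputable def IsCocycle.toHom {w : X → X → G} (hw : IsCocycle S w) (x₀ : X) :
    Pi1 S x₀ →* G :=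
  MonoidHom.mk' (Quotient.lift (fun a => Loop.hol w a) fun _ _ h => Loop.hol_congr hw h) (by
    rintro ⟨a⟩ ⟨b⟩
    obtain ⟨l, n, h1, h2⟩ := a.exists_const
    obtain ⟨l', n', h1', h2'⟩ := b.exists_const
    have h := Pi1.mk_mul_mk a b (l + n) l' h2 h1'
    change Quotient.lift _ _ (Pi1.mk a * Pi1.mk b) = Loop.hol w a * Loop.hol w b
    rw [h]
    change Loop.hol w (concat a b (l + n) l' h2 h1') = _
    rw [Loop.hol_eq hw a h1 h2, Loop.hol_eq hw b h1' h2',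
      Loop.hol_eq hw _ (l := l + l') (n := n + n') ?_ ?_, hol_add]
    · congr 1
      · refine CSpace.hol_congr n fun j h0 hj => ?_
        simp only [concat]
        rw [if_pos (by omega)]
        exact congrArg _ (by ring)
      · refine CSpace.hol_congr n' fun j h0 hj => ?_
        simp only [concat]
        split_ifs
        · rw [h2 _ (by omega), h1' _ (by omega)]
        · exact congrArg _ (by ring)
    · intro i hi
      simp only [concat]
      rw [if_pos (by omega), h1 _ (by omega)]
    · intro i hi
      push_cast at hi
      simp only [concat]
      split_ifs
      · rw [h2 _ (by omega)]
      · rw [h2' _ (by omega)])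

lemma IsCocycle.toHom_mk {w : X → X → G} (hw : IsCocycle S w) (a : Loop S x₀) {l : ℤ} {n : ℕ}
    (h1 : ∀ i ≤ l, a.1.1 i = x₀) (h2 : ∀ i ≥ l + n, a.1.1 i = x₀) :
    hw.toHom x₀ (Pi1.mk a) = hol w a.1.1 l n :=
  Loop.hol_eq hw a h1 h2

end Cocycle

/-! ### The universal cocycle, with values in the fundamental group. -/

section Universal

variable {X : Type*} {S : CSpace X} {o : X}

/-- The sequences of successively linked points which start at `o` and arrive at `x` at the
instant `0`. -/
structure PathTo (S : CSpace X) (o x : X) where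
  toFun : ℤ → X
  linked : ∀ i, S.Linked {toFun i, toFun (i + 1)}
  left : ∃ l : ℕ, ∀ i ≤ -(l : ℤ), toFun i = o
  right : ∀ i ≥ 0, toFun i = x

/-- The loop which follows `p`, waits until the instant `t`, jumps to the end point of `q`, and
comes back along `q`. -/
def glueAt {x y : X} (p : PathTo S o x) (q : PathTo S o y) (h : S.Linked {x, y}) (t : ℕ) :
    Loop S o :=
  ⟨⟨fun i => if i ≤ t then p.toFun i else q.toFun (t + 1 - i), by
    rw [isMap_line_iff]
    intro i
    rcases lt_trichotomy i t with h' | rfl | h'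
    · rw [if_pos h'.le, if_pos (by omega)]
      exact p.linked i
    · rw [if_pos le_rfl, if_neg (by omega), p.right _ (by omega), q.right _ (by omega)]
      exact h
    · rw [if_neg (by omega), if_neg (by omega), Set.pair_comm,
        show (t : ℤ) + 1 - i = t + 1 - (i + 1) + 1 by ring]
      exact q.linked _⟩, by
    obtain ⟨l, hl⟩ := p.left
    obtain ⟨l', hl'⟩ := q.left
    refine ⟨⟨-l, fun i hi => ?_⟩, ⟨l' + t + 1, fun i hi => ?_⟩⟩
    · dsimp only
      rw [if_pos (by omega), hl _ hi]
    · dsimp only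
      rw [if_neg (by omega), hl' _ (by omega)]⟩

/-- The loop which follows `p`, jumps to the end point of `q`, and comes back along `q`. -/
abbrev glue {x y : X} (p : PathTo S o x) (q : PathTo S o y) (h : S.Linked {x, y}) : Loop S o :=
  glueAt p q h 0

lemma Pi1.mk_glueAt {x y : X} (p : PathTo S o x) (q : PathTo S o y) (h : S.Linked {x, y})
    (t : ℕ) : Pi1.mk (glueAt p q h t) = Pi1.mk (glue p q h) := by
  induction t with
  | zero => rfl
  | succ t ih =>
    rw [← ih, ← Pi1.mk_delay (glueAt p q h t) t]
    congr 1
    refine loop_ext fun i => ?_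
    simp only [glueAt, delay]
    push_cast
    rcases lt_trichotomy i (t + 1) with h | rfl | h
    · rw [if_pos (by omega), if_pos (by omega), if_pos (by omega)]
    · rw [if_pos (by omega), if_neg (by omega), if_pos (by omega), p.right _ (by omega),
        p.right _ (by omega)]
    · rw [if_neg (by omega), if_neg (by omega), if_neg (by omega)]
      exact congrArg _ (by ring)

lemma Pi1.mk_eq_of_translate {a b : Loop S o} (d : ℕ) (h : ∀ i, b.1.1 i = a.1.1 (i + d)) :
    Pi1.mk b = Pi1.mk a := by
  induction d generalizing b with
  | zero => exact congrArg _ (loop_ext fun i => by simpa using h i)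
  | succ d ih =>
    -- The delay is inserted where `b` still has the value `o`, so its only effect is to translate
    -- `b` by one unit.
    rw [← ih (b := delay b (a.2.1.choose - d - 1)), Pi1.mk_delay]
    have hl := a.2.1.choose_spec
    intro i
    simp only [delay]
    split_ifs with hi
    · rw [h, hl _ (by push_cast; omega), hl _ (by omega)]
    · rw [h]
      exact congrArg _ (by push_cast; ring)

/-- A back and forth movement can be removed. -/
lemma Pi1.mk_glue_mul {x y z : X} (p : PathTo S o x) (q : PathTo S o y) (r : PathTo S o z)
    (h : S.Linked {x, y, z}) (hxy : S.Linked {x, y}) (hyz : S.Linked {y, z})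
    (hxz : S.Linked {x, z}) :
    Pi1.mk (glue p q hxy) * Pi1.mk (glue q r hyz) = Pi1.mk (glue p r hxz) := by
  obtain ⟨M, hM⟩ := q.left
  obtain ⟨lp, hlp⟩ := p.left
  obtain ⟨lr, hlr⟩ := r.left
  have hm : ∀ i ≥ (M : ℤ) + 1, (glue p q hxy).1.1 i = o := by
    intro i hi
    simp only [glueAt]
    rw [if_neg (by push_cast; omega), hM _ (by push_cast; omega)]
  have hn : ∀ i ≤ -(M : ℤ), (glue q r hyz).1.1 i = o := by
    intro i hi
    simp only [glueAt]
    rw [if_pos (by push_cast; omega), hM _ (by omega)]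
  -- At stage `j` the excursion along `q` turns round after at most `j` steps. Stage `M` is the
  -- whole concatenation, since `M` bounds the length of `q`; stage `0` just waits at `y`.
  obtain ⟨C, hC⟩ : ∃ C : ℤ → ℤ → X, C = fun j i => if i ≤ -(M : ℤ) then p.toFun (i + M) else
      if i < M + 2 then q.toFun (-min j (min (i + M - 1) (M + 1 - i))) else
      r.toFun (M + 2 - i) := ⟨_, rfl⟩
  have C1 : ∀ j i : ℤ, i ≤ -(M : ℤ) → C j i = p.toFun (i + M) := fun j i hi => by
    simp only [hC, if_pos hi]
  have C2 : ∀ j i : ℤ, -(M : ℤ) < i → i < M + 2 →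
      C j i = q.toFun (-min j (min (i + M - 1) (M + 1 - i))) := fun j i hi hi' => by
    simp only [hC, if_neg (not_le.2 hi), if_pos hi']
  have C3 : ∀ j i : ℤ, (M : ℤ) + 2 ≤ i → C j i = r.toFun (M + 2 - i) := fun j i hi => by
    simp only [hC, if_neg (show ¬ i ≤ -(M : ℤ) by omega), if_neg (not_lt.2 hi)]
  have hr' : ∀ i : ℤ, S.Linked {r.toFun (M + 2 - i), r.toFun (M + 2 - (i + 1))} := fun i => by
    have := r.linked (M + 2 - (i + 1))
    rwa [show (M : ℤ) + 2 - (i + 1) + 1 = M + 2 - i by ring, Set.pair_comm] at this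
  have hp' : ∀ i : ℤ, S.Linked {p.toFun (i + M), p.toFun (i + 1 + M)} := fun i => by
    have := p.linked (i + M)
    rwa [add_right_comm] at this
  have hb : ∀ (j i : ℤ), 0 ≤ j →
      S.Linked {C j i, C j (i + 1), C (j + 1) i, C (j + 1) (i + 1)} := by
    intro j i hj
    rcases lt_trichotomy i (-M) with hi | rfl | hi
    · rw [C1 _ _ hi.le, C1 _ _ hi.le, C1 _ _ (by omega), C1 _ _ (by omega)]
      simpa [Set.insert_comm] using hp' i
    · rw [C1 _ _ le_rfl, C1 _ _ le_rfl, C2 _ _ (by omega) (by omega),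
        C2 _ _ (by omega) (by omega), p.right _ (by omega), q.right _ (by omega),
        q.right _ (by omega)]
      simpa [Set.insert_comm] using hxy
    rcases lt_trichotomy i (M + 1) with hi' | rfl | hi'
    · rw [C2 _ _ (by omega) (by omega), C2 _ _ (by omega) (by omega),
        C2 _ _ (by omega) (by omega), C2 _ _ (by omega) (by omega)]
      obtain ⟨v, hv⟩ : ∃ v : ℤ, v = min j (min (min (i + M - 1) (M + 1 - i))
        (min (i + 1 + M - 1) (M + 1 - (i + 1)))) := ⟨_, rfl⟩
      refine S.linked_subset (q.linked (-(v + 1))) ?_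
      have e : ∀ u : ℤ, u = v ∨ u = v + 1 → q.toFun (-u) ∈
          ({q.toFun (-(v + 1)), q.toFun (-(v + 1) + 1)} : Set X) := by
        rintro u (rfl | rfl)
        · simp
        · simp
      rintro x (rfl | rfl | rfl | rfl) <;> apply e <;> omega
    · rw [C2 j (M + 1) (by omega) (by omega), C2 (j + 1) (M + 1) (by omega) (by omega),
        C3 j (M + 1 + 1) (by omega), C3 (j + 1) (M + 1 + 1) (by omega), r.right _ (by omega), q.right _ (by omega), q.right _ (by omega)]
      simpa [Set.insert_comm] using hyz
    · rw [C3 _ _ (by omega), C3 _ _ (by omega), C3 _ _ (by omega), C3 _ _ (by omega)]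
      simpa [Set.insert_comm] using hr' i
  let c : ℕ → Loop S o := fun j => ⟨⟨C j,
      isMap_line_iff.2 fun i => S.linked_subset (hb j i (by omega)) (by
        rintro x (rfl | rfl) <;> simp)⟩,
    ⟨-M - lp, fun i hi => by dsimp only; rw [C1 _ _ (by omega), hlp _ (by omega)]⟩,
    ⟨M + 2 + lr, fun i hi => by dsimp only; rw [C3 _ _ (by omega), hlr _ (by omega)]⟩⟩
  have h1 : Pi1.mk (c 0) = Pi1.mk (c M) := Pi1.mk_eq_of_chain c (fun j i => by
    simpa only [c, Nat.cast_add, Nat.cast_one] using hb j i (by omega)) M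
  have D1 : ∀ i : ℤ, i ≤ M + 1 → (glueAt p r hxz (2 * M + 1)).1.1 (i + M) =
      p.toFun (i + M) := fun i hi => by
    simp only [glueAt]
    rw [if_pos (by push_cast; omega)]
  have D2 : ∀ i : ℤ, M + 2 ≤ i → (glueAt p r hxz (2 * M + 1)).1.1 (i + M) =
      r.toFun (M + 2 - i) := fun i hi => by
    simp only [glueAt]
    rw [if_neg (by push_cast; omega)]
    exact congrArg _ (by push_cast; ring)
  let e : Loop S o := ⟨⟨fun i => (glueAt p r hxz (2 * M + 1)).1.1 (i + M),
    isMap_line_iff.2 fun i => by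
      have := loop_linked (glueAt p r hxz (2 * M + 1)) (i + M)
      rwa [add_right_comm] at this⟩, by
    obtain ⟨⟨l, hl⟩, ⟨r, hr⟩⟩ := (glueAt p r hxz (2 * M + 1)).2
    exact ⟨⟨l - M, fun i hi => hl _ (by omega)⟩, ⟨r, fun i hi => hr _ (by omega)⟩⟩⟩
  -- The loop `e` waits at `x` while `c 0` waits at `y`. In that interval both only take values in
  -- the linked set `{x, y, z}`, and elsewhere they agree.
  have h2 : Pi1.mk (c 0) = Pi1.mk e := by
    refine Pi1.sound fun i => ?_
    simp only [c, e, Nat.cast_zero]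
    rcases lt_or_ge i (-M) with hi | hi
    · rw [C1 _ _ (by omega), C1 _ _ (by omega), D1 _ (by omega), D1 _ (by omega)]
      simpa [Set.insert_comm] using hp' i
    rcases lt_or_ge (M + 1 : ℤ) i with hi' | hi'
    · rw [C3 _ _ (by omega), C3 _ _ (by omega), D2 _ (by omega), D2 _ (by omega)]
      simpa [Set.insert_comm] using hr' i
    · have k1 : ∀ i : ℤ, -(M : ℤ) ≤ i → i ≤ M + 2 → C 0 i ∈ ({x, y, z} : Set X) := by
        intro i hi hi'
        rcases eq_or_lt_of_le hi with rfl | hi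
        · rw [C1 _ _ le_rfl, p.right _ (by omega)]
          simp
        rcases eq_or_lt_of_le hi' with rfl | hi'
        · rw [C3 _ _ le_rfl, r.right _ (by omega)]
          simp
        · rw [C2 _ _ hi hi', q.right _ (by omega)]
          simp
      have k2 : ∀ i : ℤ, -(M : ℤ) ≤ i → i ≤ M + 2 →
          (glueAt p r hxz (2 * M + 1)).1.1 (i + M) ∈ ({x, y, z} : Set X) := by
        intro i hi hi'
        rcases eq_or_lt_of_le hi' with rfl | hi'
        · rw [D2 _ le_rfl, r.right _ (by omega)]
          simp
        · rw [D1 _ (by omega), p.right _ (by omega)]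
          simp
      refine S.linked_subset h ?_
      rintro u (rfl | rfl | rfl | rfl)
      exacts [k1 _ (by omega) (by omega), k1 _ (by omega) (by omega), k2 _ (by omega) (by omega),
        k2 _ (by omega) (by omega)]
  have h3 : Pi1.mk e = Pi1.mk (glueAt p r hxz (2 * M + 1)) :=
    Pi1.mk_eq_of_translate M fun i => rfl
  rw [Pi1.mk_mul_mk _ _ _ _ hm hn, ← Pi1.mk_glueAt p r hxz (2 * M + 1), ← h3, ← h2, h1]
  congr 1
  refine loop_ext fun i => ?_
  simp only [concat, glueAt, c, Nat.cast_zero, zero_add]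
  rcases le_or_gt i (-M) with hi | hi
  · rw [C1 _ _ hi, if_pos (by omega), if_pos (by omega)]
    exact congrArg _ (by ring)
  rcases le_or_gt (M + 2 : ℤ) i with h' | h'
  · rw [C3 _ _ h', if_neg (by omega), if_neg (by omega)]
    exact congrArg _ (by ring)
  rw [C2 _ _ hi h']
  rcases le_or_gt i 1 with hi' | hi'
  · rw [if_pos (by omega), if_neg (by omega)]
    exact congrArg _ (by omega)
  · rw [if_neg (by omega), if_pos (by omega)]
    exact congrArg _ (by omega)

/-- The initial part of a loop, as a path to its value at the instant `l`. -/
def Loop.trunc (a : Loop S o) (l : ℤ) (x : X) (hx : a.1.1 l = x) : PathTo S o x where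
  toFun i := a.1.1 (min i 0 + l)
  linked i := by
    rcases lt_or_ge i 0 with h | h
    · rw [min_eq_left h.le, min_eq_left (by omega), add_right_comm]
      exact loop_linked a _
    · rw [min_eq_right h, min_eq_right (by omega), Set.pair_eq_singleton]
      exact S.linked_singleton _
  left := by
    obtain ⟨⟨k, hk⟩, -⟩ := a.2
    exact ⟨(l - k).toNat, fun i hi => hk _ (by omega)⟩
  right i hi := by rw [min_eq_right hi, zero_add, hx]

/-- The constant path. -/
def PathTo.const (S : CSpace X) (o : X) : PathTo S o o where
  toFun _ := o
  linked _ := by simpa using S.linked_singleton o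
  left := ⟨0, fun _ _ => rfl⟩
  right _ _ := rfl

open Classical in
/-- The universal cocycle which is defined by a family of paths with a given origin. -/
noncomputable def univCocycle (p : ∀ x, PathTo S o x) (x y : X) : Pi1 S o :=
  if h : S.Linked {x, y} then Pi1.mk (glue (p x) (p y) h) else 1

lemma univCocycle_eq (p : ∀ x, PathTo S o x) {x y : X} (h : S.Linked {x, y}) :
    univCocycle p x y = Pi1.mk (glue (p x) (p y) h) :=
  dif_pos h

lemma isCocycle_univCocycle (p : ∀ x, PathTo S o x) : IsCocycle S (univCocycle p) := by
  intro x y z h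
  have hxy : S.Linked {x, y} := S.linked_subset h (by rintro u (rfl | rfl) <;> simp)
  have hyz : S.Linked {y, z} := S.linked_subset h (by rintro u (rfl | rfl) <;> simp)
  have hxz : S.Linked {x, z} := S.linked_subset h (by rintro u (rfl | rfl) <;> simp)
  rw [univCocycle_eq p hxy, univCocycle_eq p hyz, univCocycle_eq p hxz]
  exact Pi1.mk_glue_mul _ _ _ h hxy hyz hxz

/-- Both loops visit the same points in the same order; the first one merely repeats `y`, as the end
of the truncation and as the start of the return along `q`. A delay and a translation make them
equal. -/
lemma Pi1.mk_glue_trunc_succ (a : Loop S o) {l l' : ℤ} (hl : l' = l + 1) {x y : X}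
    (hx : a.1.1 l = x) (hy : a.1.1 l' = y) (q : PathTo S o y) (h : S.Linked {y, y})
    (h' : S.Linked {x, y}) :
    Pi1.mk (glue (a.trunc l' y hy) q h) = Pi1.mk (glue (a.trunc l x hx) q h') := by
  rw [← Pi1.mk_delay (glue (a.trunc l x hx) q h') 1, ← Pi1.mk_shift (delay _ _)]
  congr 1
  refine loop_ext fun i => ?_
  simp only [glueAt, delay, shift, Loop.trunc, Nat.cast_zero, zero_add]
  split_ifs
  all_goals first
    | omega
    | exact congrArg _ (by omega)
    | (rw [q.right _ (by omega)]; subst hy; exact congrArg _ (by omega))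

/-- The class of a loop is determined by the holonomy of the universal cocycle. -/
lemma exists_mk_eq_conj_hol (p : ∀ x, PathTo S o x) :
    ∃ u : Pi1 S o, ∀ a : Pi1 S o, a =
      u * (isCocycle_univCocycle p).toHom o a * u⁻¹ := by
  have hx : ∀ x, S.Linked {x, x} := fun x => by simpa using S.linked_singleton x
  -- The chosen path `p o` from `o` to itself need not be trivial, which accounts for the
  -- conjugation.
  refine ⟨Pi1.mk (glue (PathTo.const S o) (p o) (hx o)), ?_⟩
  rintro ⟨a⟩
  change Pi1.mk a = _ * (isCocycle_univCocycle p).toHom o (Pi1.mk a) * _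
  -- The window is enlarged so that `l + n ≥ 0`, because the final translation is by a natural
  -- number.
  obtain ⟨l, n, h1, h2, hl⟩ : ∃ (l : ℤ) (n : ℕ), (∀ i ≤ l, a.1.1 i = o) ∧
      (∀ i ≥ l + n, a.1.1 i = o) ∧ 0 ≤ l + n := by
    obtain ⟨l, n, h1, h2⟩ := a.exists_const
    exact ⟨l, n + l.natAbs, h1, fun i hi => h2 i (by omega), by omega⟩
  rw [IsCocycle.toHom_mk _ a h1 h2, eq_mul_inv_iff_mul_eq]
  -- The partial products of the holonomy are the classes of the loops which follow `a` up to the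
  -- instant `l + k` and return along the chosen path.
  have key : ∀ (k : ℕ) (x : X) (h : a.1.1 (l + k) = x),
      Pi1.mk (glue (PathTo.const S o) (p o) (hx o)) * hol (univCocycle p) a.1.1 l k =
      Pi1.mk (glue (a.trunc (l + k) x h) (p x) (hx _)) := by
    intro k
    induction k with
    | zero =>
      intro x h
      obtain rfl : o = x := by rw [← h, h1 _ (by simp)]
      rw [hol, mul_one]
      congr 1
      refine loop_ext fun i => ?_
      simp only [glueAt, PathTo.const, Loop.trunc]
      split_ifs
      · exact (h1 _ (by push_cast; omega)).symm
      · rfl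
    | succ k ih =>
      rintro y hy
      have e : l + (k + 1 : ℕ) = l + k + 1 := by push_cast; ring
      have h := loop_linked a (l + k)
      rw [← e, hy] at h
      rw [hol, ← mul_assoc, ih _ rfl, ← e, hy, univCocycle_eq p h,
        Pi1.mk_glue_mul _ _ _ (by simpa using h) _ _ h,
        ← Pi1.mk_glue_trunc_succ a e _ _ _ (hx _) h]
  have e : a.1.1 (l + n) = o := h2 _ le_rfl
  have e' : Pi1.mk a = Pi1.mk (glue (a.trunc (l + n) o e) (PathTo.const S o) (hx _)) := by
    refine (Pi1.mk_eq_of_translate (l + n).toNat fun i => ?_).symm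
    simp only [glueAt, Loop.trunc, PathTo.const]
    split_ifs
    · exact congrArg _ (by push_cast at *; omega)
    · exact (h2 _ (by push_cast at *; omega)).symm
  rw [key n o e, e', Pi1.mk_glue_mul _ _ _ (by simpa using S.linked_singleton o) _ _ (hx o)]

/-- A cocycle is, up to a gauge transformation, the image of the universal cocycle. -/
lemma IsCocycle.exists_toHom_univCocycle {G : Type*} [Group G] {w : X → X → G}
    (hw : IsCocycle S w) (p : ∀ x, PathTo S o x) : ∃ f : X → G, ∀ x y, S.Linked {x, y} →
      hw.toHom o (univCocycle p x y) = (f x)⁻¹ * w x y * f y := by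
  choose m hm using fun x => (p x).left
  -- The holonomy of `glue (p x) (p y)` is that of `p x`, times `w x y`, times the inverse of that
  -- of `p y`; hence the inverse in the gauge.
  refine ⟨fun x => (hol w (p x).toFun (-m x) (m x))⁻¹, fun x y h => ?_⟩
  have hp := hm x
  have hq := hm y
  dsimp only
  generalize m x = k at *
  generalize m y = n at *
  have e1 : ∀ i ≤ -(k : ℤ), (glue (p x) (p y) h).1.1 i = o := by
    intro i hi
    simp only [glueAt]
    rw [if_pos (by push_cast; omega), hp _ hi]
  have e2 : ∀ i ≥ -(k : ℤ) + (k + 1 + n : ℕ), (glue (p x) (p y) h).1.1 i = o := by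
    intro i hi
    push_cast at hi
    simp only [glueAt]
    rw [if_neg (by push_cast; omega), hq _ (by push_cast; omega)]
  rw [univCocycle_eq p h, hw.toHom_mk _ e1 e2, hol_add, hol_add, inv_inv,
    ← hol_reverse hw (p y).linked]
  congr 1
  · congr 1
    · refine hol_congr k fun j h0 h1 => ?_
      simp only [glueAt]
      rw [if_pos (by push_cast; omega)]
    · simp [hol, glueAt, (p x).right, (p y).right]
  · refine hol_congr n fun j h0 h1 => ?_
    simp only [glueAt]
    rw [if_neg (by push_cast; omega)]
    exact congrArg _ (by push_cast; ring)

end Universal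

/-! ### Injectivity criterion and change of base point. -/

section Criterion

variable {X G : Type*} [Group G] {S : CSpace X}

lemma exists_pathTo (h : S.Connected) (o x : X) : Nonempty (PathTo S o x) := by
  have h1 : Relation.EqvGen S.Tol o x := by
    have := h.2
    exact Quotient.exact (Subsingleton.elim (α := S.Pi0) (Quotient.mk S.connSetoid o)
      (Quotient.mk S.connSetoid x))
  have step : ∀ {x y : X}, S.Tol x y → Nonempty (PathTo S o x) → Nonempty (PathTo S o y) := by
    rintro x y hxy ⟨p⟩
    obtain ⟨l, hl⟩ := p.left
    refine ⟨⟨fun i => if i < 0 then p.toFun (i + 1) else y, fun i => ?_,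
      ⟨l + 1, fun i hi => ?_⟩, fun i hi => if_neg (not_lt.2 hi)⟩⟩
    · rcases lt_trichotomy (i + 1) 0 with h | h | h
      · rw [if_pos h, if_pos (by omega)]
        exact p.linked _
      · rw [if_pos (by omega), if_neg (by omega), p.right _ (by omega)]
        exact hxy
      · rw [if_neg (by omega), if_neg (by omega), Set.pair_eq_singleton]
        exact S.linked_singleton y
    · rw [if_pos (by omega), hl _ (by push_cast at hi; omega)]
  have key : ∀ {a b : X}, Relation.EqvGen S.Tol a b →
      (Nonempty (PathTo S o a) ↔ Nonempty (PathTo S o b)) := by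
    intro a b h
    induction h with
    | refl => rfl
    | symm _ _ _ ih => exact ih.symm
    | trans _ _ _ _ _ ih1 ih2 => exact ih1.trans ih2
    | rel a b h =>
      refine ⟨step h, step ?_⟩
      unfold Tol at *
      rwa [Set.pair_comm]
  exact (key h1).1 ⟨PathTo.const S o⟩

/-- A cocycle from which all cocycles can be deduced, up to gauge transformations, gives an
injective homomorphism. -/
theorem IsCocycle.toHom_injective {w : X → X → G} (hw : IsCocycle S w) (h : S.Connected)
    (o : X) (huniv : ∀ E : X → X → Pi1 S o, IsCocycle S E → ∃ (θ : G →* Pi1 S o)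
      (f : X → Pi1 S o), ∀ x y, S.Linked {x, y} → E x y = (f x)⁻¹ * θ (w x y) * f y) :
    Function.Injective (hw.toHom o) := by
  rw [injective_iff_map_eq_one]
  have p : ∀ x, PathTo S o x := fun x => (exists_pathTo h o x).some
  obtain ⟨u, hu⟩ := exists_mk_eq_conj_hol p
  -- The universal cocycle is itself a gauge transform of an image of `w`. If `w` has trivial
  -- holonomy along `a`, so has the universal cocycle, and this holonomy is conjugate to the class
  -- of `a`.
  obtain ⟨θ, f, hf⟩ := huniv _ (isCocycle_univCocycle p)
  rintro ⟨a⟩ ha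
  change hw.toHom o (Pi1.mk a) = 1 at ha
  change Pi1.mk a = 1
  obtain ⟨l, n, h1, h2⟩ := a.exists_const
  rw [hw.toHom_mk a h1 h2] at ha
  rw [hu (Pi1.mk a), IsCocycle.toHom_mk _ a h1 h2, hol_gauge θ f (fun i => hf _ _ (loop_linked a i)), ha,
    h1 l le_rfl, h2 _ le_rfl]
  simp

/-- The surjectivity of the homomorphism of a cocycle does not depend on the base point. -/
theorem IsCocycle.toHom_surjective {w : X → X → G} (hw : IsCocycle S w) (h : S.Connected)
    {o : X} (ho : Function.Surjective (hw.toHom o)) (x₀ : X) :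
    Function.Surjective (hw.toHom x₀) := by
  have p : ∀ x, PathTo S x₀ x := fun x => (exists_pathTo h x₀ x).some
  obtain ⟨f, hf⟩ := hw.exists_toHom_univCocycle p
  intro g
  -- The universal cocycle of paths issued from `x₀` carries loops at `o` to classes at `x₀`, and
  -- conjugates their `w`-holonomy by `f o`. The target is conjugated beforehand to compensate.
  obtain ⟨⟨a⟩, ha⟩ := ho (f o * g * (f o)⁻¹)
  change hw.toHom o (Pi1.mk a) = _ at ha
  refine ⟨(isCocycle_univCocycle p).toHom o (Pi1.mk a), ?_⟩
  obtain ⟨l, n, h1, h2⟩ := a.exists_const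
  rw [hw.toHom_mk a h1 h2] at ha
  rw [IsCocycle.toHom_mk _ a h1 h2]
  have key : hw.toHom x₀ (hol (univCocycle p) a.1.1 l n) =
      hol (fun x y => hw.toHom x₀ (univCocycle p x y)) a.1.1 l n := by
    generalize n = k
    induction k with
    | zero => exact map_one _
    | succ k ih => rw [hol, hol, map_mul, ih]
  rw [key, hol_gauge (MonoidHom.id G) f (fun i => hf _ _ (loop_linked a i)), MonoidHom.id_apply,
    ha, h1 l le_rfl, h2 _ le_rfl]
  group

end Criterion

end CSpace

/-! ### Sets of real numbers that can be traversed with steps at most `e`. -/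

/-- A set of real numbers which is exhausted by a finite increasing chain of its points, with
steps at most `e`. -/
def Chained (e : ℝ) (I : Set ℝ) : Prop :=
  ∃ (m : ℕ → ℝ) (n : ℕ), (∀ i, m i ∈ I) ∧ Monotone m ∧ (∀ i, m (i + 1) - m i ≤ e) ∧
    ∀ x ∈ I, m 0 ≤ x ∧ x ≤ m n

namespace Chained

variable {e : ℝ} {I : Set ℝ}

/-- The step relation is symmetric, so every point can be compared with the start `m 0` of the
chain, and then any two points with each other. -/
lemma induction (h : Chained e I) {P : ℝ → Prop}
    (hP : ∀ a ∈ I, ∀ b ∈ I, |a - b| ≤ e → P a → P b) {x y : ℝ} (hx : x ∈ I) (hPx : P x)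
    (hy : y ∈ I) : P y := by
  obtain ⟨m, n, hm, hmono, hstep, hbd⟩ := h
  have key : ∀ (i : ℕ), ∀ x ∈ I, x ≤ m i → (P x ↔ P (m 0)) := by
    intro i
    induction i with
    | zero =>
      intro x hx h
      rw [le_antisymm h (hbd x hx).1]
    | succ i ih =>
      intro x hx h
      rcases le_or_gt x (m i) with h' | h'
      · exact ih x hx h'
      · have h1 := hstep i
        rw [← ih (m i) (hm i) le_rfl]
        have e1 : |x - m i| ≤ e := by rw [abs_of_pos (by linarith)]; linarith
        exact ⟨hP _ hx _ (hm i) e1, hP _ (hm i) _ hx (by rwa [abs_sub_comm])⟩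
  exact (key n y hy (hbd y hy).2).2 ((key n x hx (hbd x hx).2).1 hPx)

/-- A cocycle on a chained set of real numbers is a coboundary. -/
lemma exists_potential {H : Type*} [Group H] (h : Chained e I) (E : ℝ → ℝ → H)
    (hE : ∀ a ∈ I, ∀ b ∈ I, ∀ c ∈ I, |a - b| ≤ e → |b - c| ≤ e → |a - c| ≤ e →
      E a b * E b c = E a c) (x₀ : ℝ) :
    ∃ f : ℝ → H, f x₀ = 1 ∧ ∀ a ∈ I, ∀ b ∈ I, |a - b| ≤ e → E a b = (f a)⁻¹ * f b := by
  obtain ⟨m, n, hm, hmono, hstep, hbd⟩ := h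
  have he : 0 ≤ e := (sub_nonneg.2 (hmono (Nat.le_succ 0))).trans (hstep 0)
  have hself : ∀ a ∈ I, E a a = 1 := fun a ha => by
    have := hE a ha a ha a ha (by simpa) (by simpa) (by simpa)
    simpa using this
  have hsymm : ∀ a ∈ I, ∀ b ∈ I, |a - b| ≤ e → E b a = (E a b)⁻¹ := fun a ha b hb hab => by
    rw [eq_inv_iff_mul_eq_one, hE b hb a ha b hb (by rwa [abs_sub_comm]) hab (by simpa),
      hself b hb]
  suffices key : ∀ i : ℕ, ∃ f : ℝ → H, ∀ a ∈ I, ∀ b ∈ I, a ≤ b → b ≤ m i → |a - b| ≤ e →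
      E a b = (f a)⁻¹ * f b by
    obtain ⟨f, hf⟩ := key n
    refine ⟨fun x => (f x₀)⁻¹ * f x, by simp, fun a ha b hb hab => ?_⟩
    rcases le_total a b with h | h
    · rw [hf a ha b hb h (hbd b hb).2 hab]
      group
    · rw [hsymm b hb a ha (by rwa [abs_sub_comm]),
        hf b hb a ha h (hbd a ha).2 (by rwa [abs_sub_comm])]
      group
  intro i
  induction i with
  | zero =>
    refine ⟨fun _ => 1, fun a ha b hb h1 h2 _ => ?_⟩
    obtain rfl : a = b := le_antisymm h1 (h2.trans (hbd a ha).1)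
    simp [hself a ha]
  | succ i ih =>
    obtain ⟨f, hf⟩ := ih
    -- A new point lies between `m i` and `m (i + 1)`, hence within `e` of `m i`, and gets its value
    -- through the edge from `m i`. A short pair that straddles `m i` is subdivided there.
    refine ⟨fun x => if x ≤ m i then f x else f (m i) * E (m i) x,
      fun a ha b hb h1 h2 hab => ?_⟩
    have hs := hstep i
    dsimp only
    rcases le_or_gt b (m i) with hb' | hb'
    · rw [if_pos hb', if_pos (h1.trans hb')]
      exact hf a ha b hb h1 hb' hab
    rw [if_neg (not_le.2 hb')]
    have eb : |m i - b| ≤ e := by rw [abs_of_neg (by linarith)]; linarith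
    rcases le_or_gt a (m i) with ha' | ha'
    · have ea : |a - m i| ≤ e := by
        rw [abs_sub_comm, abs_of_nonneg (by linarith)] at hab ⊢
        linarith
      rw [if_pos ha', ← hE a ha (m i) (hm i) b hb ea eb hab,
        hf a ha (m i) (hm i) ha' le_rfl ea, mul_assoc]
    · have ea : |m i - a| ≤ e := by rw [abs_of_neg (by linarith)]; linarith
      rw [if_neg (not_le.2 ha'), ← hE (m i) (hm i) a ha b hb ea hab eb]
      group

lemma grid {D : Set ℝ} {N : ℕ} (hN : 0 < N) (he : 1 / (N : ℝ) ≤ e)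
    (hD : ∀ i : ℕ, (i : ℝ) / N ∈ D) (A B : ℕ) (hAB : A ≤ B) :
    Chained e {x | x ∈ D ∧ (A : ℝ) ≤ x ∧ x ≤ B} := by
  have hN' : (0 : ℝ) < N := Nat.cast_pos.2 hN
  have hAB' : (A : ℝ) ≤ B := Nat.cast_le.2 hAB
  have hi : ∀ i : ℕ, (0 : ℝ) ≤ i / N := fun i => by positivity
  have hs : ∀ i : ℕ, ((i + 1 : ℕ) : ℝ) / N = i / N + 1 / N := fun i => by push_cast; ring
  have hp : 0 < 1 / (N : ℝ) := by positivity
  refine ⟨fun i => min (A + (i : ℝ) / N) B, B * N, fun i => ⟨?_, ?_, min_le_right _ _⟩,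
    monotone_nat_of_le_succ fun i => ?_, fun i => ?_, fun x hx => ⟨?_, ?_⟩⟩
  · beta_reduce
    rcases min_choice (A + (i : ℝ) / N) B with h | h
    · rw [h]
      convert hD (A * N + i) using 1
      push_cast
      field_simp
    · rw [h]
      convert hD (B * N) using 1
      push_cast
      field_simp
  · exact le_min (by linarith [hi i]) hAB'
  · refine min_le_min_right _ ?_
    rw [hs]
    linarith
  · dsimp only
    rw [hs]
    rcases min_choice (A + (i : ℝ) / N) B with h | h
    · rw [h]
      linarith [min_le_left (A + ((i : ℝ) / N + 1 / N)) B]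
    · rw [h]
      linarith [min_le_right (A + ((i : ℝ) / N + 1 / N)) B]
  · refine (min_le_left _ _).trans ?_
    simpa using hx.2.1
  · refine hx.2.2.trans (le_min ?_ le_rfl)
    push_cast
    rw [mul_div_cancel_right₀ _ hN'.ne']
    linarith [Nat.cast_nonneg (α := ℝ) A]

/-- A passable column is chained although it has a gap: the chain runs through the lattice, waits at
`1` until the lattice reaches `t`, and then jumps over a distance at most `e`. -/
lemma grid_gap {D : Set ℝ} {N : ℕ} (hN : 0 < N) (he : 1 / (N : ℝ) ≤ e)
    (hD : ∀ i : ℕ, (i : ℝ) / N ∈ D) (t : ℕ) (ht : 1 ≤ t) (ht' : t ≤ 5) (hte : (t : ℝ) ≤ 1 + e) :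
    Chained e {x | x ∈ D ∧ 0 ≤ x ∧ x ≤ 5 ∧ (x ≤ 1 ∨ (t : ℝ) ≤ x)} := by
  have hN' : (0 : ℝ) < N := Nat.cast_pos.2 hN
  have h1t : (1 : ℝ) ≤ t := by exact_mod_cast ht
  have ht5 : (t : ℝ) ≤ 5 := by exact_mod_cast ht'
  have hi : ∀ i : ℕ, (0 : ℝ) ≤ i / N := fun i => by positivity
  have hs : ∀ i : ℕ, ((i + 1 : ℕ) : ℝ) / N = i / N + 1 / N := fun i => by push_cast; ring
  have hp : 0 < 1 / (N : ℝ) := by positivity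
  have hlt : ∀ i : ℕ, (i : ℝ) / N < t ↔ i < t * N := fun i => by
    rw [div_lt_iff₀ hN']
    exact_mod_cast Iff.rfl
  -- As `t` is an integer it belongs to the lattice, so the jump lands on `t` and does not
  -- overshoot.
  have hsucc : ∀ i : ℕ, (i : ℝ) / N < t → (i : ℝ) / N + 1 / N ≤ t := fun i h => by
    rw [hlt] at h
    rw [← hs, div_le_iff₀ hN']
    exact_mod_cast h
  have hDn : ∀ n : ℕ, (n : ℝ) ∈ D := fun n => by
    convert hD (n * N) using 1
    push_cast
    field_simp
  refine ⟨fun i => if (i : ℝ) / N < t then min ((i : ℝ) / N) 1 else min ((i : ℝ) / N) 5, 5 * N,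
    fun i => ?_, monotone_nat_of_le_succ fun i => ?_, fun i => ?_, fun x hx => ⟨?_, ?_⟩⟩
  · dsimp only
    split_ifs with h
    · refine ⟨?_, le_min (hi i) zero_le_one, (min_le_right _ _).trans (by norm_num),
        Or.inl (min_le_right _ _)⟩
      rcases min_choice ((i : ℝ) / N) 1 with h | h
      · rw [h]
        exact hD i
      · rw [h]
        exact_mod_cast hDn 1
    · refine ⟨?_, le_min (hi i) (by norm_num), min_le_right _ _,
        Or.inr (le_min (not_lt.1 h) ht5)⟩
      rcases min_choice ((i : ℝ) / N) 5 with h | h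
      · rw [h]
        exact hD i
      · rw [h]
        exact_mod_cast hDn 5
  · rw [hs]
    split_ifs with h h' h'
    · exact min_le_min_right _ (by linarith)
    · exact min_le_min (by linarith) (by norm_num)
    · linarith
    · exact min_le_min_right _ (by linarith)
  · dsimp only
    rw [hs]
    split_ifs with h' h h
    · rcases min_choice ((i : ℝ) / N) 1 with h | h
      · rw [h]
        linarith [min_le_left ((i : ℝ) / N + 1 / N) 1]
      · rw [h]
        linarith [min_le_right ((i : ℝ) / N + 1 / N) 1]
    · linarith
    · have h2 := hsucc i h
      have h3 := min_le_left ((i : ℝ) / N + 1 / N) 5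
      rcases min_choice ((i : ℝ) / N) 1 with h | h
      · rw [h]
        linarith
      · rw [h]
        linarith
    · rcases min_choice ((i : ℝ) / N) 5 with h | h
      · rw [h]
        linarith [min_le_left ((i : ℝ) / N + 1 / N) 5]
      · rw [h]
        linarith [min_le_right ((i : ℝ) / N + 1 / N) 5]
  · beta_reduce
    rw [if_pos (by simp; linarith)]
    simpa using hx.2.1
  · have h5 : ((5 * N : ℕ) : ℝ) / N = 5 := by
      push_cast
      field_simp
    beta_reduce
    rw [h5, if_neg (not_lt.2 ht5), min_self]
    exact hx.2.2.1

end Chained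

/-! ### Potentials and cut cocycles in the plane. -/

section Plane

variable {H : Type*} [Group H] {e : ℝ}

/-- The points `p` and `q` of the plane have `l_∞`-distance at most `e`. -/
def Near (e : ℝ) (p q : ℝ × ℝ) : Prop := |p.1 - q.1| ≤ e ∧ |p.2 - q.2| ≤ e

lemma Near.symm {p q : ℝ × ℝ} (h : Near e p q) : Near e q p :=
  ⟨by rw [abs_sub_comm]; exact h.1, by rw [abs_sub_comm]; exact h.2⟩

/-- A multiplicative function on the pairs of points of `Y` at distance at most `e`. -/
def PlaneCocycle (e : ℝ) (Y : Set (ℝ × ℝ)) (E : ℝ × ℝ → ℝ × ℝ → H) : Prop :=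
  ∀ p ∈ Y, ∀ q ∈ Y, ∀ r ∈ Y, Near e p q → Near e q r → Near e p r → E p q * E q r = E p r

/-- On a union of chained columns with a common base point, such that the close columns have a
chained intersection, a cocycle is a coboundary along vertical and horizontal pairs. -/
lemma PlaneCocycle.exists_potential {Y : Set (ℝ × ℝ)} {E : ℝ × ℝ → ℝ × ℝ → H}
    (hE : PlaneCocycle e Y E) (he : 0 ≤ e) {I : Set ℝ} {J : ℝ → Set ℝ} {y₀ : ℝ}
    (hI : Chained e I) (hy₀ : ∀ s ∈ I, y₀ ∈ J s)
    (hJ : ∀ s ∈ I, ∀ s' ∈ I, |s - s'| ≤ e → Chained e (J s ∩ J s'))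
    (hY : ∀ s ∈ I, ∀ y ∈ J s, (s, y) ∈ Y) :
    ∃ f : ℝ × ℝ → H,
      (∀ s ∈ I, ∀ y ∈ J s, ∀ y' ∈ J s, |y - y'| ≤ e →
        E (s, y) (s, y') = (f (s, y))⁻¹ * f (s, y')) ∧
      ∀ s ∈ I, ∀ s' ∈ I, |s - s'| ≤ e → ∀ y ∈ J s, y ∈ J s' →
        E (s, y) (s', y) = (f (s, y))⁻¹ * f (s', y) := by
  have h0 : ∀ x : ℝ, |x - x| ≤ e := fun x => by simpa using he
  obtain ⟨ρ, -, hρ⟩ := hI.exists_potential (fun a b => E (a, y₀) (b, y₀))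
    (fun a ha b hb c hc hab hbc hac => hE _ (hY a ha _ (hy₀ a ha)) _ (hY b hb _ (hy₀ b hb)) _
      (hY c hc _ (hy₀ c hc)) ⟨hab, h0 _⟩ ⟨hbc, h0 _⟩ ⟨hac, h0 _⟩) y₀
  have hv : ∀ s : ℝ, ∃ v : ℝ → H, v y₀ = 1 ∧ (s ∈ I → ∀ y ∈ J s, ∀ y' ∈ J s, |y - y'| ≤ e →
      E (s, y) (s, y') = (v y)⁻¹ * v y') := by
    intro s
    by_cases hs : s ∈ I
    · have hJs := hJ s hs s hs (h0 s)
      rw [Set.inter_self] at hJs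
      obtain ⟨v, h1, h2⟩ := hJs.exists_potential (fun a b => E (s, a) (s, b))
        (fun a ha b hb c hc hab hbc hac => hE _ (hY s hs a ha) _ (hY s hs b hb) _
          (hY s hs c hc) ⟨h0 _, hab⟩ ⟨h0 _, hbc⟩ ⟨h0 _, hac⟩) y₀
      exact ⟨v, h1, fun _ => h2⟩
    · exact ⟨fun _ => 1, rfl, fun h => absurd h hs⟩
  choose v hv0 hv using hv
  -- Go along the row `y₀` with the potential `ρ`, then along the column with `v s`, which is
  -- normalised to `1` at `y₀`.
  refine ⟨fun p => ρ p.1 * v p.1 p.2, fun s hs y hy y' hy' h => ?_,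
    fun s hs s' hs' hss y hy hy' => ?_⟩
  · rw [hv s hs y hy y' hy' h]
    simp [mul_assoc]
  -- The formula for horizontal pairs is known at `y₀` and spreads along the common part of the two
  -- columns. Each small rectangle is split by a diagonal into two triangles.
  · refine (hJ s hs s' hs' hss).induction (P := fun y => E (s, y) (s', y) =
      (ρ s * v s y)⁻¹ * (ρ s' * v s' y)) ?_ (x := y₀) ⟨hy₀ s hs, hy₀ s' hs'⟩ ?_ ⟨hy, hy'⟩
    · rintro a ⟨ha, ha'⟩ b ⟨hb, hb'⟩ hab h
      have n1 : Near e (s, b) (s, a) := ⟨h0 _, by rw [abs_sub_comm]; exact hab⟩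
      have n2 : Near e (s, a) (s', a) := ⟨hss, h0 _⟩
      have n3 : Near e (s', a) (s', b) := ⟨h0 _, hab⟩
      have n4 : Near e (s, b) (s', a) := ⟨hss, by rw [abs_sub_comm]; exact hab⟩
      have n5 : Near e (s, b) (s', b) := ⟨hss, h0 _⟩
      rw [← hE _ (hY s hs b hb) _ (hY s' hs' a ha') _ (hY s' hs' b hb') n4 n3 n5,
        ← hE _ (hY s hs b hb) _ (hY s hs a ha) _ (hY s' hs' a ha') n1 n2 n4, h,
        hv s hs b hb a ha n1.2, hv s' hs' a ha' b hb' hab]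
      group
    · rw [hv0, hv0, mul_one, mul_one]
      exact hρ s hs s' hs' hss

/-- The cocycle which takes the value `κ q` on the pairs `(p, q)` where `p` satisfies `low` and
`q` does not. -/
noncomputable def cutCocycle {X G : Type*} [Group G] (low : X → Prop) (κ : X → G) (p q : X) : G :=
  open Classical in
  if low p then if low q then 1 else κ q else if low q then (κ p)⁻¹ else 1

/-- Only a triangle with exactly one low vertex imposes a condition: `κ` must agree at its other two
vertices. -/
lemma cutCocycle_mul {X G : Type*} [Group G] {low : X → Prop} {κ : X → G} {p q r : X}
    (hpq : low r → ¬ low p → ¬ low q → κ p = κ q) (hqr : low p → ¬ low q → ¬ low r → κ q = κ r)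
    (hpr : low q → ¬ low p → ¬ low r → κ p = κ r) :
    cutCocycle low κ p q * cutCocycle low κ q r = cutCocycle low κ p r := by
  unfold cutCocycle
  by_cases h1 : low p <;> by_cases h2 : low q <;> by_cases h3 : low r <;> simp_all

end Plane

/-! ### Classification of the cocycles on a region made of columns with a gap. -/

section Columns

variable {H : Type*} [Group H] {e : ℝ} {D : Set ℝ} {τ : ℝ → ℕ} {N : ℕ}

/-- The points with coordinates in `D` of the rectangle `[0, 11] × [0, 5]`, from which the strips
`1 < y < τ s` have been removed in the column of abscissa `s`. -/
def columnRegion (D : Set ℝ) (τ : ℝ → ℕ) : Set (ℝ × ℝ) :=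
  {p | p.1 ∈ D ∧ p.2 ∈ D ∧ 0 ≤ p.1 ∧ p.1 ≤ 11 ∧ 0 ≤ p.2 ∧ p.2 ≤ 5 ∧
    (p.2 ≤ 1 ∨ (τ p.1 : ℝ) ≤ p.2)}

/-- The lower points of the columns where the gap is larger than `e`. -/
def Low (e : ℝ) (τ : ℝ → ℕ) (p : ℝ × ℝ) : Prop := p.2 ≤ 1 ∧ 1 + e < τ p.1

/-- The function `κ` is locally constant, at resolution `e`, on the columns whose gap is at
most `e`. -/
def ColumnConst (e : ℝ) (D : Set ℝ) (τ : ℝ → ℕ) (κ : ℝ → H) : Prop :=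
  ∀ s ∈ D, ∀ s' ∈ D, 0 ≤ s → s ≤ 11 → 0 ≤ s' → s' ≤ 11 → |s - s'| ≤ e → (τ s : ℝ) ≤ 1 + e →
    (τ s' : ℝ) ≤ 1 + e → κ s = κ s'

/-- This makes the cut a cocycle: an edge can leave the low points only towards a passable column,
where `κ` is controlled. -/
lemma gap_le_of_near {p q : ℝ × ℝ} (hp : p ∈ columnRegion D τ) (hpq : Near e p q)
    (hq : q.2 ≤ 1) (h : ¬ Low e τ p) : (τ p.1 : ℝ) ≤ 1 + e := by
  rcases hp.2.2.2.2.2.2 with h' | h'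
  · exact not_lt.1 fun h'' => h ⟨h', h''⟩
  · linarith [le_abs_self (p.2 - q.2), hpq.2]

lemma ColumnConst.planeCocycle {κ : ℝ → H} (hκ : ColumnConst e D τ κ) :
    PlaneCocycle e (columnRegion D τ) (cutCocycle (Low e τ) fun p => κ p.1) := by
  have key : ∀ p ∈ columnRegion D τ, ∀ q ∈ columnRegion D τ, ∀ r, Near e p r →
      Near e q r → Near e p q → Low e τ r → ¬ Low e τ p → ¬ Low e τ q → κ p.1 = κ q.1 := by
    intro p hp q hq r hpr hqr hpq hr hpl hql
    exact hκ _ hp.1 _ hq.1 hp.2.2.1 hp.2.2.2.1 hq.2.2.1 hq.2.2.2.1 hpq.1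
      (gap_le_of_near hp hpr hr.1 hpl) (gap_le_of_near hq hqr hr.1 hql)
  intro p hp q hq r hr hpq hqr hpr
  exact cutCocycle_mul (key p hp q hq r hpr hqr hpq)
    (key q hq r hr p hpq.symm hpr.symm hqr) (key p hp r hr q hpq hqr.symm hpr)

/-- The corner of a right triangle with hypotenuse `p q` can be found in the region. -/
lemma exists_corner {p q : ℝ × ℝ} (hp : p ∈ columnRegion D τ) (hq : q ∈ columnRegion D τ) :
    (p.1, q.2) ∈ columnRegion D τ ∨ (q.1, p.2) ∈ columnRegion D τ := by
  obtain ⟨h1, h2, h3, h4, h5, h6, h7⟩ := hp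
  obtain ⟨k1, k2, k3, k4, k5, k6, k7⟩ := hq
  rcases k7 with k7 | k7
  · exact Or.inl ⟨h1, k2, h3, h4, k5, k6, Or.inl k7⟩
  rcases h7 with h7 | h7
  · exact Or.inr ⟨k1, h2, k3, k4, h5, h6, Or.inl h7⟩
  rcases le_total p.2 q.2 with h | h
  · exact Or.inl ⟨h1, k2, h3, h4, k5, k6, Or.inr (h7.trans h)⟩
  · exact Or.inr ⟨k1, h2, k3, k4, h5, h6, Or.inr (k7.trans h)⟩

/-- Every cocycle on the region is equivalent to the one which is defined by a locally constant
function on the columns with a small gap. -/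
theorem PlaneCocycle.exists_gauge {E : ℝ × ℝ → ℝ × ℝ → H}
    (hE : PlaneCocycle e (columnRegion D τ) E) (hN : 0 < N) (he : 1 / (N : ℝ) ≤ e)
    (hD : ∀ i : ℕ, (i : ℝ) / N ∈ D) (hτ : ∀ s, 1 ≤ τ s) (hτ' : ∀ s, τ s ≤ 5) :
    ∃ (κ : ℝ → H) (f : ℝ × ℝ → H), ColumnConst e D τ κ ∧
      ∀ p ∈ columnRegion D τ, ∀ q ∈ columnRegion D τ, Near e p q →
        E p q = (f p)⁻¹ * cutCocycle (Low e τ) (fun p => κ p.1) p q * f q := by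
  have he0 : 0 ≤ e := le_trans (by positivity) he
  have h0 : ∀ x : ℝ, |x - x| ≤ e := fun x => by simpa using he0
  have hDn : ∀ n : ℕ, (n : ℝ) ∈ D := fun n => by
    have hN' : (0 : ℝ) < N := Nat.cast_pos.2 hN
    convert hD (n * N) using 1
    push_cast
    field_simp
  have h0D : (0 : ℝ) ∈ D := by exact_mod_cast hDn 0
  have h5D : (5 : ℝ) ∈ D := by exact_mod_cast hDn 5
  have hI : Chained e {x | x ∈ D ∧ 0 ≤ x ∧ x ≤ 11} := by
    simpa using Chained.grid hN he hD 0 11 (by norm_num)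
  have hJ : Chained e {x | x ∈ D ∧ 0 ≤ x ∧ x ≤ 1} := by
    simpa using Chained.grid hN he hD 0 1 (by norm_num)
  -- `fD` is a potential on the lower strip.
  obtain ⟨fD, hDv, hDh⟩ := hE.exists_potential he0 (J := fun _ => {x | x ∈ D ∧ 0 ≤ x ∧ x ≤ 1})
    (y₀ := 0) hI (fun _ _ => ⟨h0D, le_rfl, zero_le_one⟩)
    (fun _ _ _ _ _ => by rwa [Set.inter_self])
    (fun s hs y hy => ⟨hs.1, hy.1, hs.2.1, hs.2.2, hy.2.1, hy.2.2.trans (by norm_num),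
      Or.inl hy.2.2⟩)
  -- The domain of the second potential `fT`: the upper part, extended down to the lower segment in
  -- the passable columns. Thus `fD` and `fT` overlap there.
  obtain ⟨JT, hJT⟩ : ∃ JT : ℝ → Set ℝ, JT = fun s => {x | x ∈ D ∧ 0 ≤ x ∧ x ≤ 5 ∧
    ((τ s : ℝ) ≤ x ∨ ((τ s : ℝ) ≤ 1 + e ∧ x ≤ 1))} := ⟨_, rfl⟩
  have hmem : ∀ s y, y ∈ JT s ↔ y ∈ D ∧ 0 ≤ y ∧ y ≤ 5 ∧
    ((τ s : ℝ) ≤ y ∨ ((τ s : ℝ) ≤ 1 + e ∧ y ≤ 1)) := fun s y => by rw [hJT]; rfl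
  have h1τ : ∀ s, (1 : ℝ) ≤ τ s := fun s => by exact_mod_cast hτ s
  obtain ⟨fT, hTv, hTh⟩ := hE.exists_potential he0 (J := JT) (y₀ := 5) hI
    (fun s _ => (hmem _ _).2 ⟨h5D, by norm_num, le_rfl, Or.inl (by exact_mod_cast hτ' s)⟩)
    (fun s _ s' _ _ => by
      by_cases hK : (τ s : ℝ) ≤ 1 + e ∧ (τ s' : ℝ) ≤ 1 + e
      · convert Chained.grid_gap hN he hD (max (τ s) (τ s')) ((hτ s).trans (le_max_left _ _))
          (max_le (hτ' s) (hτ' s')) (by rw [Nat.cast_max]; exact max_le hK.1 hK.2) using 1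
        ext y
        simp only [Set.mem_inter_iff, hmem, Set.mem_ofPred_eq, Nat.cast_max, max_le_iff]
        have := h1τ s
        have := h1τ s'
        constructor
        · rintro ⟨⟨a1, a2, a3, a4⟩, ⟨-, -, -, b4⟩⟩
          refine ⟨a1, a2, a3, ?_⟩
          rcases a4 with a4 | a4
          · rcases b4 with b4 | b4
            · exact Or.inr ⟨a4, b4⟩
            · exact Or.inl b4.2
          · exact Or.inl a4.2
        · rintro ⟨a1, a2, a3, a4 | a4⟩
          · exact ⟨⟨a1, a2, a3, Or.inr ⟨hK.1, a4⟩⟩, ⟨a1, a2, a3, Or.inr ⟨hK.2, a4⟩⟩⟩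
          · exact ⟨⟨a1, a2, a3, Or.inl a4.1⟩, ⟨a1, a2, a3, Or.inl a4.2⟩⟩
      -- If one of the two columns is not passable, only its upper segment counts, and the
      -- intersection has no gap.
      · convert Chained.grid hN he hD (max (τ s) (τ s')) 5 (max_le (hτ' s) (hτ' s')) using 1
        ext y
        simp only [Set.mem_inter_iff, hmem, Set.mem_ofPred_eq, Nat.cast_max, max_le_iff]
        have := h1τ s
        have := h1τ s'
        constructor
        · rintro ⟨⟨a1, a2, a3, a4⟩, ⟨-, -, -, b4⟩⟩
          refine ⟨a1, ?_, by exact_mod_cast a3⟩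
          rcases a4 with a4 | a4 <;> rcases b4 with b4 | b4
          · exact ⟨a4, b4⟩
          · exact absurd ⟨by linarith, b4.1⟩ hK
          · exact absurd ⟨a4.1, by linarith⟩ hK
          · exact absurd ⟨a4.1, b4.1⟩ hK
        · rintro ⟨a1, ⟨a2, a3⟩, a4⟩
          have a5 : y ≤ 5 := by exact_mod_cast a4
          exact ⟨⟨a1, by linarith, a5, Or.inl a2⟩, ⟨a1, by linarith, a5, Or.inl a3⟩⟩)
    (fun s hs y hy => by
      rw [hmem] at hy
      exact ⟨hs.1, hy.1, hs.2.1, hs.2.2, hy.2.1, hy.2.2.1, hy.2.2.2.symm.imp_left And.right⟩)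
  -- `κ s` is the discrepancy of the two potentials at the foot of the column. Both integrate `E`
  -- along the row `0`, so it does not vary between close passable columns; `hcol` shows that it is
  -- also constant up the lower segment.
  have hκ : ColumnConst e D τ fun s => fD (s, 0) * (fT (s, 0))⁻¹ := by
    intro s hs s' hs' a1 a2 b1 b2 hss hK hK'
    have h1 := hDh s ⟨hs, a1, a2⟩ s' ⟨hs', b1, b2⟩ hss 0 ⟨h0D, le_rfl, zero_le_one⟩
      ⟨h0D, le_rfl, zero_le_one⟩
    have h2 := hTh s ⟨hs, a1, a2⟩ s' ⟨hs', b1, b2⟩ hss 0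
      ((hmem _ _).2 ⟨h0D, le_rfl, by norm_num, Or.inr ⟨hK, zero_le_one⟩⟩)
      ((hmem _ _).2 ⟨h0D, le_rfl, by norm_num, Or.inr ⟨hK', zero_le_one⟩⟩)
    rw [h1, inv_mul_eq_iff_eq_mul] at h2
    beta_reduce
    rw [h2]
    group
  have hcol : ∀ p ∈ columnRegion D τ, p.2 ≤ 1 → ¬ Low e τ p →
      fD p = fD (p.1, 0) * (fT (p.1, 0))⁻¹ * fT p := by
    rintro ⟨s, y⟩ hp hy hl
    have hK : (τ s : ℝ) ≤ 1 + e := not_lt.1 fun h => hl ⟨hy, h⟩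
    have hs : s ∈ {x | x ∈ D ∧ 0 ≤ x ∧ x ≤ 11} := ⟨hp.1, hp.2.2.1, hp.2.2.2.1⟩
    refine hJ.induction (P := fun y => fD (s, y) = fD (s, 0) * (fT (s, 0))⁻¹ * fT (s, y)) ?_
      (x := 0) ⟨h0D, le_rfl, zero_le_one⟩ (by group) ⟨hp.2.1, hp.2.2.2.2.1, hy⟩
    rintro a ⟨a1, a2, a3⟩ b ⟨b1, b2, b3⟩ hab h
    have e1 := hDv s hs a ⟨a1, a2, a3⟩ b ⟨b1, b2, b3⟩ hab
    rw [hTv s hs a ((hmem _ _).2 ⟨a1, a2, a3.trans (by norm_num), Or.inr ⟨hK, a3⟩⟩) b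
      ((hmem _ _).2 ⟨b1, b2, b3.trans (by norm_num), Or.inr ⟨hK, b3⟩⟩) hab, h] at e1
    have e2 : fT (s, b) = (fD (s, 0) * (fT (s, 0))⁻¹)⁻¹ * fD (s, b) := by
      rw [mul_inv_rev, mul_assoc] at e1
      exact mul_left_cancel e1
    rw [e2]
    group
  classical
  -- The low points, which are outside the domain of `fT`, use `fD`; all others use `fT`.
  refine ⟨_, fun p => if Low e τ p then fD p else fT p, hκ, ?_⟩
  have caseD : ∀ p ∈ columnRegion D τ, ∀ q ∈ columnRegion D τ, Near e p q → p.2 ≤ 1 → q.2 ≤ 1 →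
      E p q = (fD p)⁻¹ * fD q → E p q = (if Low e τ p then fD p else fT p)⁻¹ *
        cutCocycle (Low e τ) (fun p => fD (p.1, 0) * (fT (p.1, 0))⁻¹) p q *
        (if Low e τ q then fD q else fT q) := by
    intro p hp q hq hpq hp1 hq1 h
    rw [h]
    unfold cutCocycle
    split_ifs with k1 k2 k2
    · group
    · simp only [hcol q hq hq1 k2, mul_assoc]
    · rw [hcol p hp hp1 k1]
      group
    · rw [hcol p hp hp1 k1, hcol q hq hq1 k2]
      have := hκ _ hp.1 _ hq.1 hp.2.2.1 hp.2.2.2.1 hq.2.2.1 hq.2.2.2.1 hpq.1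
        (not_lt.1 fun h => k1 ⟨hp1, h⟩) (not_lt.1 fun h => k2 ⟨hq1, h⟩)
      dsimp only at this
      rw [this]
      group
  have caseT : ∀ p q, ¬ Low e τ p → ¬ Low e τ q → E p q = (fT p)⁻¹ * fT q →
      E p q = (if Low e τ p then fD p else fT p)⁻¹ *
        cutCocycle (Low e τ) (fun p => fD (p.1, 0) * (fT (p.1, 0))⁻¹) p q *
        (if Low e τ q then fD q else fT q) := by
    intro p q k1 k2 h
    simp only [h, cutCocycle, if_neg k1, if_neg k2, mul_one]
  have memT : ∀ p ∈ columnRegion D τ, ¬ Low e τ p → p.2 ∈ JT p.1 := by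
    intro p hp hl
    refine (hmem _ _).2 ⟨hp.2.1, hp.2.2.2.2.1, hp.2.2.2.2.2.1, ?_⟩
    rcases hp.2.2.2.2.2.2 with h | h
    · exact Or.inr ⟨not_lt.1 fun h' => hl ⟨h, h'⟩, h⟩
    · exact Or.inl h
  have memI : ∀ p ∈ columnRegion D τ, p.1 ∈ {x | x ∈ D ∧ 0 ≤ x ∧ x ≤ 11} :=
    fun p hp => ⟨hp.1, hp.2.2.1, hp.2.2.2.1⟩
  have memJ : ∀ p ∈ columnRegion D τ, p.2 ≤ 1 → p.2 ∈ {x | x ∈ D ∧ 0 ≤ x ∧ x ≤ 1} :=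
    fun p hp h => ⟨hp.2.1, hp.2.2.2.2.1, h⟩
  have vert : ∀ s y y', (s, y) ∈ columnRegion D τ → (s, y') ∈ columnRegion D τ → |y - y'| ≤ e →
      E (s, y) (s, y') = (if Low e τ (s, y) then fD (s, y) else fT (s, y))⁻¹ *
        cutCocycle (Low e τ) (fun p => fD (p.1, 0) * (fT (p.1, 0))⁻¹) (s, y) (s, y') *
        (if Low e τ (s, y') then fD (s, y') else fT (s, y')) := by
    intro s y y' hp hq h
    by_cases h1 : y ≤ 1 ∧ y' ≤ 1
    · exact caseD _ hp _ hq ⟨h0 _, h⟩ h1.1 h1.2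
        (hDv s (memI _ hp) y (memJ _ hp h1.1) y' (memJ _ hq h1.2) h)
    -- A short vertical pair which crosses the gap forces the column to be passable, so neither end
    -- is low.
    · have hK : ∀ a b, (s, b) ∈ columnRegion D τ → a ≤ 1 → ¬ b ≤ 1 → |b - a| ≤ e →
          ¬ 1 + e < τ s := fun a b hb ha hb' hab hlt => by
        rcases hb.2.2.2.2.2.2 with j | j
        · exact hb' j
        · dsimp only at j
          linarith [(abs_le.1 hab).2]
      have k1 : ¬ Low e τ (s, y) := fun hl =>
        hK y y' hq hl.1 (fun h' => h1 ⟨hl.1, h'⟩) (by rwa [abs_sub_comm]) hl.2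
      have k2 : ¬ Low e τ (s, y') := fun hl =>
        hK y' y hp hl.1 (fun h' => h1 ⟨h', hl.1⟩) h hl.2
      exact caseT _ _ k1 k2 (hTv s (memI _ hp) y (memT _ hp k1) y' (memT _ hq k2) h)
  have horiz : ∀ s s' y, (s, y) ∈ columnRegion D τ → (s', y) ∈ columnRegion D τ → |s - s'| ≤ e →
      E (s, y) (s', y) = (if Low e τ (s, y) then fD (s, y) else fT (s, y))⁻¹ *
        cutCocycle (Low e τ) (fun p => fD (p.1, 0) * (fT (p.1, 0))⁻¹) (s, y) (s', y) *
        (if Low e τ (s', y) then fD (s', y) else fT (s', y)) := by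
    intro s s' y hp hq h
    by_cases h1 : y ≤ 1
    · exact caseD _ hp _ hq ⟨h, h0 _⟩ h1 h1
        (hDh s (memI _ hp) s' (memI _ hq) h y (memJ _ hp h1) (memJ _ hq h1))
    · have k1 : ¬ Low e τ (s, y) := fun h => h1 h.1
      have k2 : ¬ Low e τ (s', y) := fun h => h1 h.1
      exact caseT _ _ k1 k2 (hTh s (memI _ hp) s' (memI _ hq) h y (memT _ hp k1) (memT _ hq k2))
  -- An oblique pair is decomposed at a corner lying in the region; both cocycles are multiplicative
  -- on that triangle.
  intro p hp q hq hpq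
  rcases exists_corner hp hq with hc | hc
  · have n1 : Near e p (p.1, q.2) := ⟨h0 _, hpq.2⟩
    have n2 : Near e (p.1, q.2) q := ⟨hpq.1, h0 _⟩
    rw [← hE p hp _ hc q hq n1 n2 hpq, ← hκ.planeCocycle p hp _ hc q hq n1 n2 hpq,
      vert p.1 p.2 q.2 hp hc hpq.2, horiz p.1 q.1 q.2 hc hq hpq.1]
    simp only [Prod.mk.eta]
    group
  · have n1 : Near e p (q.1, p.2) := ⟨hpq.1, h0 _⟩
    have n2 : Near e (q.1, p.2) q := ⟨h0 _, hpq.2⟩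
    rw [← hE p hp _ hc q hq n1 n2 hpq, ← hκ.planeCocycle p hp _ hc q hq n1 n2 hpq,
      horiz p.1 q.1 p.2 hp hc hpq.1, vert q.1 p.2 q.2 hc hq hpq.2]
    simp only [Prod.mk.eta]
    group

end Columns

/-! ### Sequences running along polygons, with prescribed holonomy. -/

section Runs

variable {G : Type*} [Group G]

lemma exists_path_of_reflTransGen {X : Type*} {S : CSpace X} {Z : Set X} {x y : X} (hx : x ∈ Z)
    (h : Relation.ReflTransGen (fun x y => x ∈ Z ∧ y ∈ Z ∧ S.Linked {x, y}) x y) :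
    ∃ (a : ℤ → X) (n : ℕ), (∀ i, S.Linked {a i, a (i + 1)}) ∧ (∀ i ≤ 0, a i = x) ∧
      (∀ i ≥ (n : ℤ), a i = y) ∧ ∀ i, a i ∈ Z := by
  induction h with
  | refl => exact ⟨fun _ => x, 0, fun i => by simpa using S.linked_singleton x, fun _ _ => rfl,
      fun _ _ => rfl, fun _ => hx⟩
  | @tail y z _ hyz ih =>
    obtain ⟨a, n, h1, h2, h3, h4⟩ := ih
    refine ⟨fun i => if i ≤ n then a i else z, n + 1, fun i => ?_, fun i hi => ?_,
      fun i hi => ?_, fun i => ?_⟩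
    · beta_reduce
      rcases lt_trichotomy i n with h | rfl | h
      · rw [if_pos h.le, if_pos (by omega)]
        exact h1 i
      · rw [if_pos le_rfl, if_neg (by omega), h3 _ le_rfl]
        exact hyz.2.2
      · rw [if_neg (by omega), if_neg (by omega), Set.pair_eq_singleton]
        exact S.linked_singleton z
    · beta_reduce
      rw [if_pos (by omega), h2 i hi]
    · beta_reduce
      rw [if_neg (by push_cast at hi; omega)]
    · dsimp only
      split_ifs
      exacts [h4 i, hyz.2.1]

/-- There is a sequence of successively linked points which runs along the polygonal line `P`, on
which the cocycle `w` has the holonomy `v`. -/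
def HasRun {Y : Set (ℝ × ℝ)} (S : CSpace Y) (w : Y → Y → G) {n : ℕ} (P : Fin (n + 1) → ℝ × ℝ)
    (v : G) : Prop :=
  ∃ (a : ℤ → Y) (t : Fin (n + 1) → ℤ), (∀ i, S.Linked {a i, a (i + 1)}) ∧ Monotone t ∧
    (∀ i ≤ t 0, (a i : ℝ × ℝ) = P 0) ∧
    (∀ i ≥ t (Fin.last n), (a i : ℝ × ℝ) = P (Fin.last n)) ∧
    (∀ k, (a (t k) : ℝ × ℝ) = P k) ∧
    (∀ (k : Fin n) (i : ℤ), t k.castSucc ≤ i → i ≤ t k.succ →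
      (a i : ℝ × ℝ) ∈ segment ℝ (P k.castSucc) (P k.succ)) ∧
    CSpace.hol w a (t 0) (t (Fin.last n) - t 0).toNat = v

variable {Y : Set (ℝ × ℝ)} {S : CSpace Y} {w : Y → Y → G}

lemma HasRun.nil (S : CSpace Y) (w : Y → Y → G) {p : ℝ × ℝ} (hp : p ∈ Y) :
    HasRun S w ![p] 1 :=
  ⟨fun _ => ⟨p, hp⟩, fun _ => 0, fun _ => by simpa using S.linked_singleton _,
    monotone_const, fun _ _ => rfl, fun _ _ => rfl, fun k => by simp, fun k => k.elim0, rfl⟩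

/-- Runs are built backwards from their last vertex. The new edge stays in a set `Z` on which `w` is
the coboundary of `m`, so its contribution depends only on its end points. -/
lemma HasRun.cons {n : ℕ} {P : Fin (n + 1) → ℝ × ℝ} {v : G} (h : HasRun S w P v) {x y : Y}
    (hy : P 0 = y) {Z : Set Y} (hx : x ∈ Z)
    (hxy : Relation.ReflTransGen (fun x y => x ∈ Z ∧ y ∈ Z ∧ S.Linked {x, y}) x y)
    (hZ : ∀ z ∈ Z, (z : ℝ × ℝ) ∈ segment ℝ (x : ℝ × ℝ) y) (m : Y → G)
    (hm : ∀ z ∈ Z, ∀ z' ∈ Z, S.Linked {z, z'} → w z z' = (m z)⁻¹ * m z') :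
    HasRun S w (Matrix.vecCons (x : ℝ × ℝ) P) ((m x)⁻¹ * m y * v) := by
  obtain ⟨b, t, b1, bt, b2, b3, b4, b5, b6⟩ := h
  obtain ⟨a, N, a1, a2, a3, a4⟩ := exists_path_of_reflTransGen hx hxy
  have hb : b (t 0) = y := Subtype.ext ((b4 0).trans hy)
  have hlast : t 0 ≤ t (Fin.last n) := bt (Fin.zero_le _)
  obtain ⟨c, hc⟩ : ∃ c : ℤ → Y, c = fun i => if i ≤ t 0 then a (i - t 0 + N) else b i :=
    ⟨_, rfl⟩
  have c1 : ∀ i ≤ t 0, c i = a (i - t 0 + N) := fun i hi => by rw [hc]; exact if_pos hi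
  have c2 : ∀ i ≥ t 0, c i = b i := fun i hi => by
    rcases eq_or_lt_of_le hi with rfl | hi
    · rw [c1 _ le_rfl, a3 _ (by omega), hb]
    · rw [hc]
      exact if_neg (by omega)
  refine ⟨c, Fin.cons (t 0 - N) t, fun i => ?_, ?_, fun i hi => ?_, fun i hi => ?_, ?_, ?_, ?_⟩
  · rcases lt_or_ge i (t 0) with h | h
    · rw [c1 _ h.le, c1 _ (by omega), show i + 1 - t 0 + N = i - t 0 + N + 1 by ring]
      exact a1 _
    · rw [c2 _ h, c2 _ (by omega)]
      exact b1 i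
  · intro i j hij
    induction i using Fin.cases with
    | zero =>
      induction j using Fin.cases with
      | zero => exact le_rfl
      | succ j =>
        have := bt (Fin.zero_le j)
        simp only [Fin.cons_zero, Fin.cons_succ]
        omega
    | succ i =>
      induction j using Fin.cases with
      | zero => exact absurd hij (by simp)
      | succ j =>
        simp only [Fin.cons_succ]
        exact bt (Fin.succ_le_succ_iff.1 hij)
  · simp only [Fin.cons_zero] at hi
    rw [c1 _ (by omega), a2 _ (by omega)]
    rfl
  · rw [← Fin.succ_last, Fin.cons_succ] at hi
    rw [c2 _ (by omega), b3 _ hi, ← Fin.succ_last]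
    rfl
  · intro k
    induction k using Fin.cases with
    | zero =>
      rw [Fin.cons_zero, c1 _ (by omega), a2 _ (by omega)]
      rfl
    | succ k =>
      rw [Fin.cons_succ, c2 _ (bt (Fin.zero_le k)), b4]
      rfl
  · intro k i h1 h2
    induction k using Fin.cases with
    | zero =>
      simp only [Fin.castSucc_zero, Fin.cons_zero, Fin.cons_succ] at h1 h2
      rw [c1 _ h2]
      have := hZ _ (a4 (i - t 0 + N))
      rw [← hy] at this
      exact this
    | succ k =>
      rw [← Fin.succ_castSucc, Fin.cons_succ] at h1
      rw [Fin.cons_succ] at h2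
      rw [c2 _ ((bt (Fin.zero_le _)).trans h1)]
      exact b5 k i h1 h2
  · rw [← Fin.succ_last, Fin.cons_succ, Fin.cons_zero,
      show (t (Fin.last n) - (t 0 - N)).toNat = N + (t (Fin.last n) - t 0).toNat by omega,
      CSpace.hol_add, sub_add_cancel]
    congr 1
    · rw [CSpace.hol_congr (b := a) (l' := 0) N fun j h0 h1 => by
        rw [c1 _ (by omega)]
        exact congrArg _ (by ring),
        CSpace.hol_telescope m N fun i => hm _ (a4 i) _ (a4 _) (a1 i), a2 _ le_rfl,
        a3 _ (by omega)]
    · rw [← b6]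
      exact CSpace.hol_congr _ fun j h0 h1 => c2 _ (by omega)

lemma HasRun.exists_loop (hw : S.IsCocycle w) {n : ℕ} {P : Fin (n + 1) → ℝ × ℝ} {v : G}
    (h : HasRun S w P v) {o : Y} (h0 : P 0 = o) (h1 : P (Fin.last n) = o) :
    ∃ γ : S.Loop o, RunsAlong (fun i => (γ.1.1 i : ℝ × ℝ)) P ∧
      hw.toHom o (CSpace.Pi1.mk γ) = v := by
  obtain ⟨a, t, a1, at', a2, a3, a4, a5, a6⟩ := h
  have a2' : ∀ i ≤ t 0, a i = o := fun i hi => Subtype.ext ((a2 i hi).trans h0)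
  have a3' : ∀ i ≥ t (Fin.last n), a i = o := fun i hi => Subtype.ext ((a3 i hi).trans h1)
  refine ⟨⟨⟨a, CSpace.isMap_line_iff.2 a1⟩, ⟨_, a2'⟩, ⟨_, a3'⟩⟩,
    ⟨t, at', a2, a3, a4, a5⟩, ?_⟩
  have := at' (Fin.zero_le (Fin.last n))
  rw [hw.toHom_mk _ a2' (n := (t (Fin.last n) - t 0).toNat) (fun i hi => a3' i (by omega)), a6]

end Runs

/-! ### Connectedness and injectivity for column regions. -/

section Region

variable {G : Type*} [Group G] {e : ℝ} {D : Set ℝ} {τ : ℝ → ℕ}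

/-- The set of coordinates `D` contains a lattice with steps at most `e`, and the gap heights are
in the range `1, …, 5`. -/
structure GridData (e : ℝ) (D : Set ℝ) (τ : ℝ → ℕ) : Prop where
  grid : ∃ N : ℕ, 0 < N ∧ 1 / (N : ℝ) ≤ e ∧ ∀ i : ℕ, (i : ℝ) / N ∈ D
  one_le : ∀ s, 1 ≤ τ s
  le_five : ∀ s, τ s ≤ 5

/-- The linked parts are the finite subsets of diameter at most `e`. -/
def IsResolution (e : ℝ) {Y : Set (ℝ × ℝ)} (S : CSpace Y) : Prop :=
  ∀ ξ : Set Y, S.Linked ξ ↔ ξ.Finite ∧ ∀ x ∈ ξ, ∀ y ∈ ξ, Near e (x : ℝ × ℝ) y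

lemma GridData.nonneg (hd : GridData e D τ) : 0 ≤ e := by
  obtain ⟨N, -, h, -⟩ := hd.grid
  exact le_trans (by positivity) h

lemma GridData.natCast_mem (hd : GridData e D τ) (n : ℕ) : (n : ℝ) ∈ D := by
  obtain ⟨N, hN, -, hD⟩ := hd.grid
  have hN' : (0 : ℝ) < N := Nat.cast_pos.2 hN
  convert hD (n * N) using 1
  push_cast
  field_simp

lemma GridData.chained (hd : GridData e D τ) (A B : ℕ) (hAB : A ≤ B) :
    Chained e {x | x ∈ D ∧ (A : ℝ) ≤ x ∧ x ≤ B} := by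
  obtain ⟨N, hN, he, hD⟩ := hd.grid
  exact Chained.grid hN he hD A B hAB

lemma GridData.chained_column (hd : GridData e D τ) {s : ℝ} (hs : (τ s : ℝ) ≤ 1 + e) :
    Chained e {x | x ∈ D ∧ 0 ≤ x ∧ x ≤ 5 ∧ (x ≤ 1 ∨ (τ s : ℝ) ≤ x)} := by
  obtain ⟨N, hN, he, hD⟩ := hd.grid
  exact Chained.grid_gap hN he hD (τ s) (hd.one_le s) (hd.le_five s) hs

lemma near_self (he : 0 ≤ e) (p : ℝ × ℝ) : Near e p p := by
  constructor <;> simpa using he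

lemma near_horizontal {s s' y : ℝ} (he : 0 ≤ e) (h : |s - s'| ≤ e) : Near e (s, y) (s', y) :=
  ⟨h, by simpa using he⟩

lemma near_vertical {s y y' : ℝ} (he : 0 ≤ e) (h : |y - y'| ≤ e) : Near e (s, y) (s, y') :=
  ⟨by simpa using he, h⟩

lemma IsResolution.pair {Y : Set (ℝ × ℝ)} {S : CSpace Y} (hS : IsResolution e S) (he : 0 ≤ e)
    {x y : Y} : S.Linked {x, y} ↔ Near e (x : ℝ × ℝ) y := by
  rw [hS]
  constructor
  · exact fun h => h.2 x (by simp) y (by simp)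
  · refine fun h => ⟨Set.toFinite _, ?_⟩
    rintro u (rfl | rfl) v (rfl | rfl)
    exacts [near_self he _, h, h.symm, near_self he _]

lemma PlaneCocycle.isCocycle {Y : Set (ℝ × ℝ)} {S : CSpace Y} (hS : IsResolution e S)
    {W : ℝ × ℝ → ℝ × ℝ → G} (hW : PlaneCocycle e Y W) :
    S.IsCocycle fun x y : Y => W x y := by
  intro x y z h
  have h := ((hS _).1 h).2
  exact hW x x.2 y y.2 z z.2 (h x (by simp) y (by simp)) (h y (by simp) z (by simp))
    (h x (by simp) z (by simp))

open Classical in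
lemma CSpace.IsCocycle.exists_planeCocycle {Y : Set (ℝ × ℝ)} {S : CSpace Y}
    (hS : IsResolution e S) (he : 0 ≤ e) {E : Y → Y → G} (hE : S.IsCocycle E) :
    ∃ W : ℝ × ℝ → ℝ × ℝ → G, PlaneCocycle e Y W ∧ ∀ x y : Y, W x y = E x y := by
  refine ⟨fun p q => if h : p ∈ Y ∧ q ∈ Y then E ⟨p, h.1⟩ ⟨q, h.2⟩ else 1,
    fun p hp q hq r hr hpq hqr hpr => ?_, fun x y => by simp⟩
  beta_reduce
  rw [dif_pos ⟨hp, hq⟩, dif_pos ⟨hq, hr⟩, dif_pos ⟨hp, hr⟩]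
  refine hE _ _ _ ((hS _).2 ⟨Set.toFinite _, ?_⟩)
  rintro u (rfl | rfl | rfl) v (rfl | rfl | rfl)
  exacts [near_self he _, hpq, hpr, hpq.symm, near_self he _, hqr, hpr.symm, hqr.symm,
    near_self he _]

variable {S : CSpace (columnRegion D τ)}

lemma mem_row_zero (hd : GridData e D τ) {s : ℝ} (hs : s ∈ D) (h0 : 0 ≤ s) (h1 : s ≤ 11) :
    (s, (0 : ℝ)) ∈ columnRegion D τ :=
  ⟨hs, by exact_mod_cast hd.natCast_mem 0, h0, h1, le_rfl, by norm_num, Or.inl zero_le_one⟩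

lemma mem_row_five (hd : GridData e D τ) {s : ℝ} (hs : s ∈ D) (h0 : 0 ≤ s) (h1 : s ≤ 11) :
    (s, (5 : ℝ)) ∈ columnRegion D τ :=
  ⟨hs, by exact_mod_cast hd.natCast_mem 5, h0, h1, by norm_num, le_rfl,
    Or.inr (show (τ s : ℝ) ≤ 5 by exact_mod_cast hd.le_five s)⟩

/-- The passable column `0` joins the bottom row to the top row, and every other point is reached
vertically from one of these rows. -/
theorem IsResolution.connected (hS : IsResolution e S) (hd : GridData e D τ)
    (h0 : (τ 0 : ℝ) ≤ 1 + e) : S.Connected := by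
  have he := hd.nonneg
  have h0D : (0 : ℝ) ∈ D := by exact_mod_cast hd.natCast_mem 0
  have ho := mem_row_zero hd h0D le_rfl (by norm_num)
  let o : columnRegion D τ := ⟨(0, 0), ho⟩
  have step : ∀ x y : columnRegion D τ, Near e (x : ℝ × ℝ) y → Relation.EqvGen S.Tol o x →
      Relation.EqvGen S.Tol o y := fun x y h hx =>
    hx.trans _ _ _ (Relation.EqvGen.rel _ _ ((hS.pair he).2 h))
  have hI : Chained e {x | x ∈ D ∧ 0 ≤ x ∧ x ≤ 11} := by
    simpa using hd.chained 0 11 (by norm_num)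
  have row0 : ∀ s (hs : s ∈ D) (h0 : 0 ≤ s) (h1 : s ≤ 11),
      Relation.EqvGen S.Tol o ⟨(s, 0), mem_row_zero hd hs h0 h1⟩ := by
    intro s hs h0 h1
    refine hI.induction (P := fun s => ∀ h : (s, (0 : ℝ)) ∈ columnRegion D τ,
      Relation.EqvGen S.Tol o ⟨(s, 0), h⟩) ?_ (x := 0) ⟨h0D, le_rfl, by norm_num⟩
      (fun h => Relation.EqvGen.refl _) ⟨hs, h0, h1⟩ _
    intro a ha b hb hab h hb'
    exact step _ _ (near_horizontal he hab) (h (mem_row_zero hd ha.1 ha.2.1 ha.2.2))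
  have o5 : Relation.EqvGen S.Tol o ⟨(0, 5), mem_row_five hd h0D le_rfl (by norm_num)⟩ := by
    have h1 : (1 : ℝ) ≤ τ 0 := by exact_mod_cast hd.one_le 0
    refine (hd.chained_column h0).induction (P := fun y => ∀ h : ((0 : ℝ), y) ∈ columnRegion D τ,
      Relation.EqvGen S.Tol o ⟨(0, y), h⟩) ?_ (x := 0)
      ⟨h0D, le_rfl, by norm_num, Or.inl zero_le_one⟩
      (fun h => Relation.EqvGen.refl _) ⟨by exact_mod_cast hd.natCast_mem 5, by norm_num, le_rfl,
        Or.inr (by exact_mod_cast hd.le_five 0)⟩ _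
    intro a ha b hb hab h hb'
    exact step _ _ (near_vertical he hab)
      (h ⟨h0D, ha.1, le_rfl, by norm_num, ha.2.1, ha.2.2.1, ha.2.2.2⟩)
  have row5 : ∀ s (hs : s ∈ D) (h0 : 0 ≤ s) (h1 : s ≤ 11),
      Relation.EqvGen S.Tol o ⟨(s, 5), mem_row_five hd hs h0 h1⟩ := by
    intro s hs h0 h1
    refine hI.induction (P := fun s => ∀ h : (s, (5 : ℝ)) ∈ columnRegion D τ,
      Relation.EqvGen S.Tol o ⟨(s, 5), h⟩) ?_ (x := 0) ⟨h0D, le_rfl, by norm_num⟩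
      (fun h => o5) ⟨hs, h0, h1⟩ _
    intro a ha b hb hab h hb'
    exact step _ _ (near_horizontal he hab) (h (mem_row_five hd ha.1 ha.2.1 ha.2.2))
  have key : ∀ x : columnRegion D τ, Relation.EqvGen S.Tol o x := by
    rintro ⟨⟨s, y⟩, hx⟩
    obtain ⟨h1, h2, h3, h4, h5, h6, h7 | h7⟩ := id hx
    · have hc : Chained e {x | x ∈ D ∧ 0 ≤ x ∧ x ≤ 1} := by
        simpa using hd.chained 0 1 (by norm_num)
      refine hc.induction (P := fun y => ∀ h : (s, y) ∈ columnRegion D τ,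
        Relation.EqvGen S.Tol o ⟨(s, y), h⟩) ?_ (x := 0) ⟨h0D, le_rfl, zero_le_one⟩
        (fun h => row0 s h1 h3 h4) ⟨h2, h5, h7⟩ _
      intro a ha b hb hab h hb'
      exact step _ _ (near_vertical he hab)
        (h ⟨h1, ha.1, h3, h4, ha.2.1, ha.2.2.trans (by norm_num), Or.inl ha.2.2⟩)
    · have h5' : (τ s : ℝ) ≤ 5 := by exact_mod_cast hd.le_five s
      refine (hd.chained (τ s) 5 (hd.le_five s)).induction
        (P := fun y => ∀ h : (s, y) ∈ columnRegion D τ,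
        Relation.EqvGen S.Tol o ⟨(s, y), h⟩) ?_ (x := 5)
        ⟨by exact_mod_cast hd.natCast_mem 5, h5', by norm_num⟩
        (fun h => row5 s h1 h3 h4) ⟨h2, h7, by exact_mod_cast h6⟩ _
      intro a ha b hb hab h hb'
      exact step _ _ (near_vertical he hab)
        (h ⟨h1, ha.1, h3, h4, le_trans (Nat.cast_nonneg _) ha.2.1,
          by exact_mod_cast ha.2.2, Or.inr ha.2.1⟩)
  refine ⟨⟨Quotient.mk _ o⟩, ⟨?_⟩⟩
  rintro ⟨x⟩ ⟨y⟩
  exact Quotient.sound (((key x).symm _ _).trans _ _ _ (key y))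

/-- The cocycle of a locally constant function on the columns with a small gap. -/
noncomputable def columnCocycle (e : ℝ) (D : Set ℝ) (τ : ℝ → ℕ) (k : ℝ → G)
    (x y : columnRegion D τ) : G :=
  cutCocycle (Low e τ) (fun p => k p.1) (x : ℝ × ℝ) y

lemma ColumnConst.isCocycle (hS : IsResolution e S) {k : ℝ → G} (hk : ColumnConst e D τ k) :
    S.IsCocycle (columnCocycle e D τ k) :=
  hk.planeCocycle.isCocycle hS

/-- By the classification, universality among cocycles reduces to universality among locally
constant functions on the passable columns, up to a left translation `u`. -/
theorem ColumnConst.toHom_injective (hS : IsResolution e S) (hd : GridData e D τ)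
    (h0 : (τ 0 : ℝ) ≤ 1 + e) {k : ℝ → G} (hk : ColumnConst e D τ k)
    (huniv : ∀ {H : Type} [Group H] (κ : ℝ → H), ColumnConst e D τ κ → ∃ (θ : G →* H) (u : H),
      ∀ s ∈ D, 0 ≤ s → s ≤ 11 → (τ s : ℝ) ≤ 1 + e → κ s = u * θ (k s))
    (x₀ : columnRegion D τ) : Function.Injective ((hk.isCocycle hS).toHom x₀) := by
  classical
  have he := hd.nonneg
  obtain ⟨N, hN, heN, hD⟩ := hd.grid
  refine CSpace.IsCocycle.toHom_injective _ (hS.connected hd h0) x₀ fun E hE => ?_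
  obtain ⟨W, hW, hWE⟩ := hE.exists_planeCocycle hS he
  obtain ⟨κ, f, hκ, hf⟩ := hW.exists_gauge hN heN hD hd.one_le hd.le_five
  obtain ⟨θ, u, hu⟩ := huniv κ hκ
  -- The translation `u` is absorbed by changing the gauge at the low points only.
  refine ⟨θ, fun x => if Low e τ x then u⁻¹ * f x else f x, fun x y hxy => ?_⟩
  have hxy := (hS.pair he).1 hxy
  have hK : ∀ x y : columnRegion D τ, Near e (x : ℝ × ℝ) y → ¬ Low e τ x → Low e τ y →
      κ x.1.1 = u * θ (k x.1.1) := fun x y hxy hx hy =>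
    hu _ x.2.1 x.2.2.2.1 x.2.2.2.2.1 (gap_le_of_near x.2 hxy hy.1 hx)
  rw [← hWE, hf x x.2 y y.2 hxy]
  simp only [columnCocycle, cutCocycle]
  split_ifs with h1 h2 h2
  · simp [mul_assoc]
  · rw [hK y x hxy.symm h2 h1]
    group
  · rw [hK x y hxy h1 h2, map_inv]
    group
  · simp

end Region

/-! ### Edges of polygons: only the bottom row contributes to the holonomy. -/

section Runs

variable {G : Type*} [Group G] {e : ℝ} {D : Set ℝ} {τ : ℝ → ℕ} {S : CSpace (columnRegion D τ)}

lemma HasRun.cons_horizontal (hS : IsResolution e S) (hd : GridData e D τ) {k : ℝ → G} {n : ℕ}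
    {P : Fin (n + 1) → ℝ × ℝ} {v : G} (h : HasRun S (columnCocycle e D τ k) P v) {y : ℝ}
    (hY : ∀ s ∈ D, 0 ≤ s → s ≤ 11 → (s, y) ∈ columnRegion D τ) (A B : ℕ) (hAB : A ≤ B)
    (hB : B ≤ 11) {s s' : ℝ} (hs : s = A ∧ s' = B ∨ s = B ∧ s' = A) (hP : P 0 = (s', y))
    (m : ℝ × ℝ → G) (hm : ∀ p ∈ columnRegion D τ, ∀ q ∈ columnRegion D τ, Near e p q →
      p.2 = y → q.2 = y → cutCocycle (Low e τ) (fun p => k p.1) p q = (m p)⁻¹ * m q) :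
    HasRun S (columnCocycle e D τ k) (Matrix.vecCons (s, y) P)
      ((m (s, y))⁻¹ * m (s', y) * v) := by
  have he := hd.nonneg
  have hAB' : (A : ℝ) ≤ B := Nat.cast_le.2 hAB
  have hB' : (B : ℝ) ≤ 11 := by exact_mod_cast hB
  have hA' : (0 : ℝ) ≤ A := Nat.cast_nonneg _
  have hI := hd.chained A B hAB
  have hsI : s ∈ {x | x ∈ D ∧ (A : ℝ) ≤ x ∧ x ≤ B} := by
    rcases hs with ⟨rfl, -⟩ | ⟨rfl, -⟩
    exacts [⟨hd.natCast_mem A, le_rfl, hAB'⟩, ⟨hd.natCast_mem B, hAB', le_rfl⟩]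
  have hsI' : s' ∈ {x | x ∈ D ∧ (A : ℝ) ≤ x ∧ x ≤ B} := by
    rcases hs with ⟨-, rfl⟩ | ⟨-, rfl⟩
    exacts [⟨hd.natCast_mem B, hAB', le_rfl⟩, ⟨hd.natCast_mem A, le_rfl, hAB'⟩]
  have hmem : ∀ u ∈ {x | x ∈ D ∧ (A : ℝ) ≤ x ∧ x ≤ B}, (u, y) ∈ columnRegion D τ :=
    fun u hu => hY u hu.1 (hA'.trans hu.2.1) (hu.2.2.trans hB')
  refine h.cons (x := ⟨(s, y), hmem s hsI⟩) (y := ⟨(s', y), hmem s' hsI'⟩) hP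
    (Z := {z | z.1.2 = y ∧ (A : ℝ) ≤ z.1.1 ∧ z.1.1 ≤ B}) ⟨rfl, hsI.2⟩ ?_ ?_
    (fun z => m z) ?_
  · generalize_proofs h1 h2
    generalize hZ : {z : columnRegion D τ | z.1.2 = y ∧ (A : ℝ) ≤ z.1.1 ∧ z.1.1 ≤ B} = Z
    refine hI.induction (P := fun u => ∀ hu : (u, y) ∈ columnRegion D τ,
      Relation.ReflTransGen (fun x y => x ∈ Z ∧ y ∈ Z ∧ S.Linked {x, y}) ⟨(s, y), h1⟩
        ⟨(u, y), hu⟩) ?_ hsI (fun _ => Relation.ReflTransGen.refl) hsI' _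
    intro a ha b hb hab h hb'
    subst hZ
    exact (h (hmem a ha)).tail ⟨⟨rfl, ha.2⟩, ⟨rfl, hb.2⟩,
      (hS.pair he).2 (near_horizontal he hab)⟩
  · rintro ⟨⟨u, y'⟩, hz⟩ ⟨rfl, h1, h2⟩
    rw [← Prod.image_mk_segment_left]
    refine ⟨u, ?_, rfl⟩
    rw [segment_eq_uIcc]
    rcases hs with ⟨rfl, rfl⟩ | ⟨rfl, rfl⟩
    · exact Set.mem_uIcc_of_le h1 h2
    · exact Set.mem_uIcc_of_ge h1 h2
  · intro z hz z' hz' h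
    exact hm z z.2 z' z'.2 ((hS.pair he).1 h) hz.1 hz'.1

lemma HasRun.cons_top (hS : IsResolution e S) (hd : GridData e D τ) {k : ℝ → G} {n : ℕ}
    {P : Fin (n + 1) → ℝ × ℝ} {v : G} (h : HasRun S (columnCocycle e D τ k) P v) (A B : ℕ)
    (hAB : A ≤ B) (hB : B ≤ 11) {s s' : ℝ} (hs : s = A ∧ s' = B ∨ s = B ∧ s' = A)
    (hP : P 0 = (s', 5)) : HasRun S (columnCocycle e D τ k) (Matrix.vecCons (s, 5) P) v := by
  have := h.cons_horizontal hS hd (fun s => mem_row_five hd) A B hAB hB hs hP (fun _ => 1)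
    (fun p hp q hq hpq hp5 hq5 => by
      have hlow : ∀ p : ℝ × ℝ, p.2 = 5 → ¬ Low e τ p := fun p hp hl => by
        have := hl.1
        norm_num [hp] at this
      rw [cutCocycle, if_neg (hlow p hp5), if_neg (hlow q hq5)]
      simp)
  simpa using this

/-- On the row `0` the cut cocycle has the potential `1` at low points and `k` at the others; the
edge may pass through columns that are not passable, but its ends are in passable ones. -/
lemma HasRun.cons_bottom (hS : IsResolution e S) (hd : GridData e D τ) {k : ℝ → G}
    (hk : ColumnConst e D τ k) {n : ℕ} {P : Fin (n + 1) → ℝ × ℝ} {v : G}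
    (h : HasRun S (columnCocycle e D τ k) P v) (A B : ℕ) (hAB : A ≤ B) (hB : B ≤ 11) {s s' : ℝ}
    (hs : s = A ∧ s' = B ∨ s = B ∧ s' = A) (hP : P 0 = (s', 0)) (hgs : (τ s : ℝ) ≤ 1 + e)
    (hgs' : (τ s' : ℝ) ≤ 1 + e) :
    HasRun S (columnCocycle e D τ k) (Matrix.vecCons (s, 0) P) ((k s)⁻¹ * k s' * v) := by
  classical
  have := h.cons_horizontal hS hd (fun s => mem_row_zero hd) A B hAB hB hs hP
    (fun p => if Low e τ p then 1 else k p.1)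
    (fun p hp q hq hpq hp0 hq0 => by
      have hg : ∀ p : ℝ × ℝ, p.2 = 0 → ¬ Low e τ p → (τ p.1 : ℝ) ≤ 1 + e := fun p hp hl =>
        not_lt.1 fun h => hl ⟨by rw [hp]; exact zero_le_one, h⟩
      unfold cutCocycle
      split_ifs with h1 h2 h2
      · simp
      · simp
      · simp
      · rw [hk _ hp.1 _ hq.1 hp.2.2.1 hp.2.2.2.1 hq.2.2.1 hq.2.2.2.1 hpq.1 (hg p hp0 h1)
          (hg q hq0 h2)]
        simp)
  simpa only [if_neg (show ¬ Low e τ (s, 0) from fun h => not_lt.2 hgs h.2),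
    if_neg (show ¬ Low e τ (s', 0) from fun h => not_lt.2 hgs' h.2)] using this

/-- A passable column has no low point, so the cocycle is trivial along it. -/
lemma HasRun.cons_vertical (hS : IsResolution e S) (hd : GridData e D τ) {k : ℝ → G} {n : ℕ}
    {P : Fin (n + 1) → ℝ × ℝ} {v : G} (h : HasRun S (columnCocycle e D τ k) P v) (A : ℕ)
    (hA : A ≤ 11) {s : ℝ} (hsA : s = A) (hgs : (τ s : ℝ) ≤ 1 + e) {y y' : ℝ}
    (hy : y = 0 ∧ y' = 5 ∨ y = 5 ∧ y' = 0) (hP : P 0 = (s, y')) :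
    HasRun S (columnCocycle e D τ k) (Matrix.vecCons (s, y) P) v := by
  have he := hd.nonneg
  have hsD : s ∈ D := hsA ▸ hd.natCast_mem A
  have hs0 : 0 ≤ s := hsA ▸ Nat.cast_nonneg _
  have hs11 : s ≤ 11 := hsA ▸ by exact_mod_cast hA
  have hJ := hd.chained_column hgs
  have h0 : (0 : ℝ) ∈ {x | x ∈ D ∧ 0 ≤ x ∧ x ≤ 5 ∧ (x ≤ 1 ∨ (τ s : ℝ) ≤ x)} :=
    ⟨by exact_mod_cast hd.natCast_mem 0, le_rfl, by norm_num, Or.inl zero_le_one⟩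
  have h5 : (5 : ℝ) ∈ {x | x ∈ D ∧ 0 ≤ x ∧ x ≤ 5 ∧ (x ≤ 1 ∨ (τ s : ℝ) ≤ x)} :=
    ⟨by exact_mod_cast hd.natCast_mem 5, by norm_num, le_rfl,
      Or.inr (by exact_mod_cast hd.le_five s)⟩
  have hyJ : y ∈ {x | x ∈ D ∧ 0 ≤ x ∧ x ≤ 5 ∧ (x ≤ 1 ∨ (τ s : ℝ) ≤ x)} := by
    rcases hy with ⟨rfl, -⟩ | ⟨rfl, -⟩
    exacts [h0, h5]
  have hyJ' : y' ∈ {x | x ∈ D ∧ 0 ≤ x ∧ x ≤ 5 ∧ (x ≤ 1 ∨ (τ s : ℝ) ≤ x)} := by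
    rcases hy with ⟨-, rfl⟩ | ⟨-, rfl⟩
    exacts [h5, h0]
  have hmem : ∀ u ∈ {x | x ∈ D ∧ 0 ≤ x ∧ x ≤ 5 ∧ (x ≤ 1 ∨ (τ s : ℝ) ≤ x)},
      (s, u) ∈ columnRegion D τ :=
    fun u hu => ⟨hsD, hu.1, hs0, hs11, hu.2⟩
  have := h.cons (x := ⟨(s, y), hmem y hyJ⟩) (y := ⟨(s, y'), hmem y' hyJ'⟩) hP
    (Z := {z | z.1.1 = s}) rfl ?_ ?_ (fun z => 1) ?_
  · simpa using this
  · generalize_proofs h1 h2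
    generalize hZ : {z : columnRegion D τ | z.1.1 = s} = Z
    refine hJ.induction (P := fun u => ∀ hu : (s, u) ∈ columnRegion D τ,
      Relation.ReflTransGen (fun x y => x ∈ Z ∧ y ∈ Z ∧ S.Linked {x, y}) ⟨(s, y), h1⟩
        ⟨(s, u), hu⟩) ?_ hyJ (fun _ => Relation.ReflTransGen.refl) hyJ' _
    intro a ha b hb hab h hb'
    subst hZ
    exact (h (hmem a ha)).tail ⟨rfl, rfl, (hS.pair he).2 (near_vertical he hab)⟩
  · rintro ⟨⟨s', u⟩, hz⟩ rfl
    rw [← Prod.image_mk_segment_right]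
    refine ⟨u, ?_, rfl⟩
    rw [segment_eq_uIcc]
    have h1 : 0 ≤ u := hz.2.2.2.2.1
    have h2 : u ≤ 5 := hz.2.2.2.2.2.1
    rcases hy with ⟨rfl, rfl⟩ | ⟨rfl, rfl⟩
    · exact Set.mem_uIcc_of_le h1 h2
    · exact Set.mem_uIcc_of_ge h1 h2
  · intro z hz z' hz' _
    have hl : ∀ z : columnRegion D τ, z.1.1 = s → ¬ Low e τ z := fun z hz hl => by
      have := hl.2
      rw [hz] at this
      linarith
    rw [columnCocycle, cutCocycle, if_neg (hl z hz), if_neg (hl z' hz')]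
    simp


lemma ColumnConst.eq_of_mem_interval {K : Type*} {κ : ℝ → K} (hκ : ColumnConst e D τ κ)
    (hd : GridData e D τ) (A B : ℕ) (hAB : A ≤ B) (hB : B ≤ 11)
    (hg : ∀ s : ℝ, A ≤ s → s ≤ B → (τ s : ℝ) ≤ 1 + e) {s s' : ℝ} (hs : s ∈ D) (h1 : A ≤ s)
    (h2 : s ≤ B) (hs' : s' ∈ D) (h1' : A ≤ s') (h2' : s' ≤ B) : κ s = κ s' := by
  have hA' : (0 : ℝ) ≤ A := Nat.cast_nonneg _
  have hB' : (B : ℝ) ≤ 11 := by exact_mod_cast hB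
  refine (hd.chained A B hAB).induction (P := fun u => κ s = κ u) ?_ (x := s) ⟨hs, h1, h2⟩ rfl
    ⟨hs', h1', h2'⟩
  intro a ha b hb hab h
  rw [h]
  exact hκ a ha.1 b hb.1 (hA'.trans ha.2.1) (ha.2.2.trans hB') (hA'.trans hb.2.1)
    (hb.2.2.trans hB') hab (hg a ha.2.1 ha.2.2) (hg b hb.2.1 hb.2.2)

end Runs

/-! ### Free groups. -/

section FreeGroups

/-- `φ` is a left inverse of the lift, and an injective left inverse is a two-sided one. -/
lemma FreeGroup.lift_bijective_of_injective {ι P : Type*} [Group P] (φ : P →* FreeGroup ι)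
    (hφ : Function.Injective φ) (γ : ι → P) (h : ∀ i, φ (γ i) = FreeGroup.of i) :
    Function.Bijective (FreeGroup.lift γ) ∧ Function.Surjective φ := by
  have key : ∀ x, φ (FreeGroup.lift γ x) = x := by
    have : φ.comp (FreeGroup.lift γ) = MonoidHom.id _ := by
      ext i
      simp [h]
    exact DFunLike.congr_fun this
  exact ⟨⟨Function.LeftInverse.injective key, fun p => ⟨φ p, hφ (key _)⟩⟩,
    fun x => ⟨_, key x⟩⟩

/-- The free group on two generators is the free product of two infinite cyclic groups. -/
noncomputable def FreeGroup.finTwoEquivCoprod :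
    FreeGroup (Fin 2) ≃* Monoid.Coprod (Multiplicative ℤ) (Multiplicative ℤ) :=
  MonoidHom.toMulEquiv
    (FreeGroup.lift ![Monoid.Coprod.inl (Multiplicative.ofAdd 1),
      Monoid.Coprod.inr (Multiplicative.ofAdd 1)])
    (Monoid.Coprod.lift (zpowersHom _ (FreeGroup.of 0)) (zpowersHom _ (FreeGroup.of 1)))
    (by
      ext i
      fin_cases i <;> simp)
    (by
      ext <;> simp)

end FreeGroups

/-! ### The concrete region, and the components of its passable columns. -/

section Cases

/-- The lower bound of the upper part of the column of abscissa `s` in the planar region. -/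
noncomputable def gap (c : ℕ) (s : ℝ) : ℕ :=
  -- The value `1` encodes a column without gap. The abscissas `4` and `c` get the value `2` because
  -- `B` contains its vertical sides, unlike `A` and `C`.
  if s ≤ 1 then 1 else if s < 4 then 4 else if s ≤ c then 2 else if s < 10 then 3 else 1

lemma one_le_gap (c : ℕ) (s : ℝ) : 1 ≤ gap c s := by
  unfold gap
  split_ifs <;> norm_num

lemma gap_le_five (c : ℕ) (s : ℝ) : gap c s ≤ 5 := by
  unfold gap
  split_ifs <;> norm_num

variable {c : ℕ} {e : ℝ} {D : Set ℝ} {S : CSpace (columnRegion D (gap c))}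

lemma gap_of_le_one {s : ℝ} (h : s ≤ 1) : gap c s = 1 := if_pos h

lemma gap_of_mem_Ioo {s : ℝ} (h : 1 < s) (h' : s < 4) : gap c s = 4 := by
  rw [gap, if_neg (not_le.2 h), if_pos h']

lemma gap_of_mem_Icc {s : ℝ} (h : 4 ≤ s) (h' : s ≤ c) : gap c s = 2 := by
  rw [gap, if_neg (by linarith), if_neg (by linarith), if_pos h']

lemma gap_of_mem_Ioo' {s : ℝ} (h : 4 ≤ s) (h' : c < s) (h'' : s < 10) : gap c s = 3 := by
  rw [gap, if_neg (by linarith), if_neg (by linarith), if_neg (by linarith), if_pos h'']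

lemma gap_of_ge_ten (hc' : c ≤ 8) {s : ℝ} (h : 10 ≤ s) : gap c s = 1 := by
  have : (c : ℝ) ≤ 8 := by exact_mod_cast hc'
  rw [gap, if_neg (by linarith), if_neg (by linarith), if_neg (by linarith), if_neg (by linarith)]

lemma gap_cases (hc' : c ≤ 8) (s : ℝ) :
    (s ≤ 1 ∧ gap c s = 1) ∨ (1 < s ∧ s < 4 ∧ gap c s = 4) ∨ (4 ≤ s ∧ s ≤ c ∧ gap c s = 2) ∨
      (4 ≤ s ∧ c < s ∧ s < 10 ∧ gap c s = 3) ∨ (10 ≤ s ∧ gap c s = 1) := by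
  rcases le_or_gt s 1 with h1 | h1
  · exact Or.inl ⟨h1, gap_of_le_one h1⟩
  rcases lt_or_ge s 4 with h2 | h2
  · exact Or.inr (Or.inl ⟨h1, h2, gap_of_mem_Ioo h1 h2⟩)
  rcases le_or_gt s c with h3 | h3
  · exact Or.inr (Or.inr (Or.inl ⟨h2, h3, gap_of_mem_Icc h2 h3⟩))
  rcases lt_or_ge s 10 with h4 | h4
  · exact Or.inr (Or.inr (Or.inr (Or.inl ⟨h2, h3, h4, gap_of_mem_Ioo' h2 h3 h4⟩)))
  · exact Or.inr (Or.inr (Or.inr (Or.inr ⟨h4, gap_of_ge_ten hc' h4⟩)))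

lemma mem_planarRegion_iff (hc : 4 < c) (hc' : c ≤ 8) (p : ℝ × ℝ) :
    p ∈ planarRegion c ↔ 0 ≤ p.1 ∧ p.1 ≤ 11 ∧ 0 ≤ p.2 ∧ p.2 ≤ 5 ∧
      (p.2 ≤ 1 ∨ (gap c p.1 : ℝ) ≤ p.2) := by
  obtain ⟨s, y⟩ := p
  have hc4 : (4 : ℝ) < c := by exact_mod_cast hc
  simp only [planarRegion, Set.mem_sdiff, Set.mem_prod, Set.mem_union, Set.mem_Icc, Set.mem_Ioo]
  constructor
  · rintro ⟨⟨⟨h1, h2⟩, h3, h4⟩, h5⟩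
    refine ⟨h1, h2, h3, h4, ?_⟩
    by_contra! h6
    apply h5
    rcases gap_cases hc' s with h | h | h | h | h
    · rw [h.2] at h6
      norm_num at h6
      linarith
    · rw [h.2.2] at h6
      norm_num at h6
      exact Or.inl (Or.inl ⟨⟨h.1, h.2.1⟩, h6⟩)
    · rw [h.2.2] at h6
      norm_num at h6
      exact Or.inl (Or.inr ⟨⟨h.1, h.2.1⟩, h6⟩)
    · rw [h.2.2.2] at h6
      norm_num at h6
      exact Or.inr ⟨⟨h.2.1, h.2.2.1⟩, h6⟩
    · rw [h.2] at h6
      norm_num at h6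
      linarith
  · rintro ⟨h1, h2, h3, h4, h5⟩
    refine ⟨⟨⟨h1, h2⟩, h3, h4⟩, ?_⟩
    rintro ((⟨⟨a1, a2⟩, a3, a4⟩ | ⟨⟨a1, a2⟩, a3, a4⟩) | ⟨⟨a1, a2⟩, a3, a4⟩)
    · rw [gap_of_mem_Ioo a1 a2] at h5
      norm_num at h5
      rcases h5 with h5 | h5 <;> linarith
    · rw [gap_of_mem_Icc a1 a2] at h5
      norm_num at h5
      rcases h5 with h5 | h5 <;> linarith
    · rw [gap_of_mem_Ioo' (by linarith) a1 a2] at h5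
      norm_num at h5
      rcases h5 with h5 | h5 <;> linarith

lemma planarRegion_eq (hc : 4 < c) (hc' : c ≤ 8) : planarRegion c = columnRegion Set.univ (gap c) := by
  ext p
  rw [mem_planarRegion_iff hc hc']
  simp [columnRegion]

lemma digitalModel_eq (hc : 4 < c) (hc' : c ≤ 8) (k : ℕ) : digitalModel (planarRegion c) k =
    columnRegion {x | ∃ i : ℤ, x = (i : ℝ) / k} (gap c) := by
  ext ⟨s, y⟩
  simp only [digitalModel, Set.mem_inter_iff, mem_planarRegion_iff hc hc', columnRegion,
    Set.mem_ofPred_eq, Prod.mk.injEq]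
  constructor
  · rintro ⟨h, i, j, hi, hj⟩
    exact ⟨⟨i, hi⟩, ⟨j, hj⟩, h⟩
  · rintro ⟨⟨i, hi⟩, ⟨j, hj⟩, h⟩
    exact ⟨h, i, j, hi, hj⟩

/-- Universality of `leftCut`, whose two values are the inverse of the generator and `1`. -/
lemma exists_hom_of_two_values {H : Type*} [Group H] (a b : H) :
    ∃ (θ : FreeGroup Unit →* H) (u : H), a = u * θ (FreeGroup.of ())⁻¹ ∧ b = u * θ 1 :=
  ⟨FreeGroup.lift fun _ => a⁻¹ * b, b, by simp, by simp⟩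

/-- The function on the columns whose cocycle detects a loop around the first hole. -/
noncomputable def leftCut (s : ℝ) : FreeGroup Unit := if s ≤ 1 then (FreeGroup.of ())⁻¹ else 1

/-- The function on the columns whose cocycle detects loops around the two holes. -/
noncomputable def doubleCut (s : ℝ) : FreeGroup (Fin 2) :=
  if s ≤ 1 then (FreeGroup.of 0)⁻¹ else
    -- The conjugation is chosen so that the loop around `C`, based at the origin and thus starting
    -- in the first component, has holonomy exactly `FreeGroup.of 1`.
    if s < 10 then 1 else (FreeGroup.of 0)⁻¹ * FreeGroup.of 1 * FreeGroup.of 0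

/-- The fundamental group when the columns with a small gap are those in `[0, 1] ∪ [M, 11]`. -/
lemma pi1_of_two_components (hS : IsResolution e S) (hd : GridData e D (gap c))
    (M : ℕ) (hM : M ≤ 11) (hM1 : 1 + e < M)
    (hsmall : ∀ s : ℝ, M ≤ s → (gap c s : ℝ) ≤ 1 + e)
    (hlarge : ∀ s : ℝ, 1 < s → s < M → 1 + e < gap c s) :
    ∃ hk : ColumnConst e D (gap c) leftCut, (∀ x₀, Function.Injective
      ((hk.isCocycle hS).toHom x₀)) := by
  have he := hd.nonneg
  have h1 : ∀ s : ℝ, s ≤ 1 → (gap c s : ℝ) ≤ 1 + e := fun s hs => by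
    rw [gap_of_le_one hs]
    norm_num
    exact he
  have hcase : ∀ s : ℝ, (gap c s : ℝ) ≤ 1 + e → s ≤ 1 ∨ M ≤ s := fun s hs => by
    by_contra! h
    exact absurd (hlarge s h.1 h.2) (not_lt.2 hs)
  -- Since `M > 1 + e`, columns of different components are never within `e` of each other.
  have hk : ColumnConst e D (gap c) leftCut := by
    intro s hs s' hs' a1 a2 b1 b2 hss hg hg'
    have := abs_le.1 hss
    unfold leftCut
    rcases hcase s hg with h | h <;> rcases hcase s' hg' with h' | h'
    · rw [if_pos h, if_pos h']
    · linarith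
    · linarith
    · rw [if_neg (by linarith), if_neg (by linarith)]
  refine ⟨hk, hk.toHom_injective hS hd (h1 0 zero_le_one) fun κ hκ => ?_⟩
  obtain ⟨θ, u, ha, hb⟩ := exists_hom_of_two_values (κ 0) (κ 11)
  refine ⟨θ, u, fun s hs hs0 hs11 hg => ?_⟩
  unfold leftCut
  have hM' : (M : ℝ) ≤ 11 := by exact_mod_cast hM
  rcases hcase s hg with h | h
  · rw [if_pos h, ← ha]
    exact hκ.eq_of_mem_interval hd 0 1 (by norm_num) (by norm_num)
      (fun s _ h => h1 s (by simpa using h)) hs (by simpa using hs0) (by simpa using h)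
      (by exact_mod_cast hd.natCast_mem 0) (by simp) (by simp)
  · rw [if_neg (by linarith), ← hb]
    exact hκ.eq_of_mem_interval hd M 11 hM le_rfl (fun s h _ => hsmall s h) hs h
      (by simpa using hs11) (by exact_mod_cast hd.natCast_mem 11) hM' (by simp)

/-- The passable abscissas form `[0, 1]`, `[4, c]` and `[10, 11]`. As `c ≤ 8`, their mutual
distances are at least `2 > e`, so the three values of `doubleCut` are independent. -/
lemma pi1_of_three_components (hc : 4 < c) (hc' : c ≤ 8) (hS : IsResolution e S)
    (hd : GridData e D (gap c)) (h1e : 1 ≤ e) (he2 : e < 2) :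
    ∃ hk : ColumnConst e D (gap c) doubleCut, (∀ x₀, Function.Injective
      ((hk.isCocycle hS).toHom x₀)) := by
  have he := hd.nonneg
  have hc4 : (4 : ℝ) < c := by exact_mod_cast hc
  have hc8 : (c : ℝ) ≤ 8 := by exact_mod_cast hc'
  have h1 : ∀ s : ℝ, s ≤ 1 → (gap c s : ℝ) ≤ 1 + e := fun s hs => by
    rw [gap_of_le_one hs]
    norm_num
    exact he
  have hcase : ∀ s : ℝ, (gap c s : ℝ) ≤ 1 + e → s ≤ 1 ∨ (4 ≤ s ∧ s ≤ c) ∨ 10 ≤ s :=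
    fun s hs => by
    rcases gap_cases hc' s with h | h | h | h | h
    · exact Or.inl h.1
    · rw [h.2.2] at hs
      norm_num at hs
      linarith
    · exact Or.inr (Or.inl ⟨h.1, h.2.1⟩)
    · rw [h.2.2.2] at hs
      norm_num at hs
      linarith
    · exact Or.inr (Or.inr h.1)
  have v1 : ∀ s : ℝ, s ≤ 1 → doubleCut s = (FreeGroup.of 0)⁻¹ := fun s h => if_pos h
  have v2 : ∀ s : ℝ, 4 ≤ s ∧ s ≤ c → doubleCut s = 1 := fun s h => by
    rw [doubleCut, if_neg (by linarith), if_pos (by linarith)]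
  have v3 : ∀ s : ℝ, 10 ≤ s →
      doubleCut s = (FreeGroup.of 0)⁻¹ * FreeGroup.of 1 * FreeGroup.of 0 := fun s h => by
    rw [doubleCut, if_neg (by linarith), if_neg (by linarith)]
  have hk : ColumnConst e D (gap c) doubleCut := by
    intro s hs s' hs' a1 a2 b1 b2 hss hg hg'
    have := abs_le.1 hss
    rcases hcase s hg with h | h | h <;> rcases hcase s' hg' with h' | h' | h'
    · rw [v1 s h, v1 s' h']
    · linarith
    · linarith
    · linarith
    · rw [v2 s h, v2 s' h']
    · linarith
    · linarith
    · linarith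
    · rw [v3 s h, v3 s' h']
  refine ⟨hk, hk.toHom_injective hS hd (h1 0 zero_le_one) fun κ hκ => ?_⟩
  -- With `u = κ c`, the images of the generators are forced by the values `κ 0` and `κ 11` on the
  -- outer components.
  refine ⟨FreeGroup.lift ![(κ 0)⁻¹ * κ c, ((κ 0)⁻¹ * κ c) * ((κ c)⁻¹ * κ 11) *
    ((κ 0)⁻¹ * κ c)⁻¹], κ c, fun s hs hs0 hs11 hg => ?_⟩
  rcases hcase s hg with h | h | h
  · rw [v1 s h, hκ.eq_of_mem_interval hd 0 1 (by norm_num) (by norm_num)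
      (fun s _ h => h1 s (by simpa using h)) hs (by simpa using hs0) (by simpa using h)
      (s' := 0) (by exact_mod_cast hd.natCast_mem 0) (by simp) (by simp)]
    simp
  · rw [v2 s h, hκ.eq_of_mem_interval hd 4 c hc.le (by omega)
      (fun s h h' => by
        rw [gap_of_mem_Icc (by simpa using h) h']
        norm_num
        linarith) hs (by simpa using h.1) (by simpa using h.2)
      (s' := c) (hd.natCast_mem c) (by simpa using hc4.le) (by simp)]
    simp
  · rw [v3 s h, hκ.eq_of_mem_interval hd 10 11 (by norm_num) (by norm_num)
      (fun s h _ => by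
        rw [gap_of_ge_ten hc' (by simpa using h)]
        norm_num
        linarith) hs (by simpa using h) (by simpa using hs11)
      (s' := 11) (by exact_mod_cast hd.natCast_mem 11) (by norm_num) (by norm_num)]
    simp only [map_mul, map_inv, FreeGroup.lift_apply_of, Matrix.cons_val_zero,
      Matrix.cons_val_one]
    group

/-- All gaps satisfy `τ s ≤ 4 ≤ 1 + e`, so every `κ` is constant and the cocycle with values in the
trivial group is already universal. -/
lemma pi1_of_one_component (hc' : c ≤ 8) (hS : IsResolution e S) (hd : GridData e D (gap c))
    (he3 : 3 ≤ e) (x₀ : columnRegion D (gap c)) : Subsingleton (S.Pi1 x₀) := by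
  have hg : ∀ s : ℝ, (gap c s : ℝ) ≤ 1 + e := fun s => by
    rcases gap_cases hc' s with h | h | h | h | h
    · rw [h.2]
      norm_num
      linarith
    · rw [h.2.2]
      norm_num
      linarith
    · rw [h.2.2]
      norm_num
      linarith
    · rw [h.2.2.2]
      norm_num
      linarith
    · rw [h.2]
      norm_num
      linarith
  have hk : ColumnConst e D (gap c) fun _ => (1 : Multiplicative Unit) :=
    fun _ _ _ _ _ _ _ _ _ _ _ => rfl
  refine (hk.toHom_injective hS hd (hg 0) (fun κ hκ => ⟨1, κ 0, fun s hs h0 h1 _ => ?_⟩)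
    x₀).subsingleton
  rw [hκ.eq_of_mem_interval hd 0 11 (by norm_num) le_rfl (fun s _ _ => hg s) hs
    (by simpa using h0) (by simpa using h1) (s' := 0) (by exact_mod_cast hd.natCast_mem 0)
    (by simp) (by simp)]
  simp

end Cases

/-! ### From extended resolutions to real ones. -/

section Resolution

variable {D : Set ℝ} {τ : ℝ → ℕ} {ε : ℝ≥0∞}

lemma min_hundred_ne_top (ε : ℝ≥0∞) : min ε 100 ≠ ⊤ :=
  ne_top_of_le_ne_top (by norm_num) (min_le_right _ _)

lemma natCast_le_toReal_min_iff (n : ℕ) (hn : n ≤ 100) :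
    (n : ℝ) ≤ (min ε 100).toReal ↔ (n : ℝ≥0∞) ≤ ε := by
  rw [← ENNReal.ofReal_le_iff_le_toReal (min_hundred_ne_top ε), ENNReal.ofReal_natCast, le_min_iff,
    and_iff_left (by exact_mod_cast hn)]

/-- Distances in the region are at most `11`, so capping `ε` at `100` changes no linked set; it
makes the resolution a real number even when `ε = ∞`. -/
lemma isResolution_resolution (D : Set ℝ) (τ : ℝ → ℕ) (ε : ℝ≥0∞) :
    IsResolution (min ε 100).toReal (CSpace.resolution (columnRegion D τ) ε) := by
  intro ξ
  change ξ.Finite ∧ Metric.ediam ξ ≤ ε ↔ _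
  rw [Metric.ediam_le_iff]
  refine and_congr_right fun _ => forall₄_congr fun x _ y _ => ?_
  have key : ∀ d : ℝ, d ≤ 100 → (ENNReal.ofReal d ≤ ε ↔ d ≤ (min ε 100).toReal) := fun d hd => by
    rw [← ENNReal.ofReal_le_iff_le_toReal (min_hundred_ne_top ε), le_min_iff, iff_self_and]
    intro _
    rw [show (100 : ℝ≥0∞) = ENNReal.ofReal 100 by norm_num]
    exact ENNReal.ofReal_le_ofReal hd
  obtain ⟨-, -, h1, h2, h3, h4, -⟩ := x.2
  obtain ⟨-, -, k1, k2, k3, k4, -⟩ := y.2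
  rw [Subtype.edist_eq, Prod.edist_eq, max_le_iff, edist_dist, edist_dist, Real.dist_eq,
    Real.dist_eq, key _ (abs_le.2 ⟨by linarith, by linarith⟩),
    key _ (abs_le.2 ⟨by linarith, by linarith⟩)]
  rfl

lemma gridData_univ (hε : 0 < ε) (h1 : ∀ s, 1 ≤ τ s) (h5 : ∀ s, τ s ≤ 5) :
    GridData (min ε 100).toReal Set.univ τ := by
  refine ⟨?_, h1, h5⟩
  have h : 0 < (min ε 100).toReal := ENNReal.toReal_pos (by simp [hε.ne']) (min_hundred_ne_top ε)
  obtain ⟨n, hn⟩ := exists_nat_one_div_lt h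
  exact ⟨n + 1, n.succ_pos, by exact_mod_cast hn.le, fun _ => Set.mem_univ _⟩

lemma gridData_lattice {k : ℕ} (hk : 0 < k) (hε : (k : ℝ≥0∞)⁻¹ ≤ ε) (h1 : ∀ s, 1 ≤ τ s)
    (h5 : ∀ s, τ s ≤ 5) :
    GridData (min ε 100).toReal {x | ∃ i : ℤ, x = (i : ℝ) / k} τ := by
  refine ⟨⟨k, hk, ?_, fun i => ⟨i, by push_cast; rfl⟩⟩, h1, h5⟩
  have hk' : (1 : ℝ≥0∞) ≤ k := by exact_mod_cast hk
  rw [← ENNReal.ofReal_le_iff_le_toReal (min_hundred_ne_top ε), one_div,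
    ENNReal.ofReal_inv_of_pos (Nat.cast_pos.2 hk), ENNReal.ofReal_natCast]
  exact le_min hε ((ENNReal.inv_le_one.2 hk').trans (by norm_num))

end Resolution

/-! ### The three nontrivial ranges of `ε`, and the final assembly. -/

section Final

variable {c : ℕ} {D : Set ℝ} {e : ℝ} {S : CSpace (columnRegion D (gap c))}

lemma mem_origin {τ : ℝ → ℕ} (hd : GridData e D τ) : ((0 : ℝ), (0 : ℝ)) ∈ columnRegion D τ :=
  mem_row_zero hd (by exact_mod_cast hd.natCast_mem 0) le_rfl (by norm_num)

/-- The class of a loop on which the detecting cocycle has the value of the generator generates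
freely the fundamental group, which is infinite cyclic at each base point. -/
lemma infinite_cyclic_of_run (hS : IsResolution e S) (hd : GridData e D (gap c))
    (hk : ColumnConst e D (gap c) leftCut)
    (hinj : ∀ x₀, Function.Injective ((hk.isCocycle hS).toHom x₀)) {n : ℕ}
    {P : Fin (n + 1) → ℝ × ℝ} (h0 : P 0 = (0, 0)) (h1 : P (Fin.last n) = (0, 0))
    (hrun : HasRun S (columnCocycle e D (gap c) leftCut) P (FreeGroup.of ())) :
    (∀ x₀, Nonempty (S.Pi1 x₀ ≃* Multiplicative ℤ)) ∧
      ∃ γ : S.Loop ⟨(0, 0), mem_origin hd⟩, RunsAlong (fun i => (γ.1.1 i : ℝ × ℝ)) P ∧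
        Function.Bijective (FreeGroup.lift fun _ : Unit => CSpace.Pi1.mk γ) := by
  have hcon := hS.connected hd (by
    rw [gap_of_le_one zero_le_one, Nat.cast_one]
    linarith [hd.nonneg])
  obtain ⟨γ, hγ, hv⟩ := hrun.exists_loop (hk.isCocycle hS) (o := ⟨(0, 0), mem_origin hd⟩) h0 h1
  obtain ⟨hb, hs⟩ := FreeGroup.lift_bijective_of_injective _ (hinj _)
    (fun _ : Unit => CSpace.Pi1.mk γ) fun _ => hv
  exact ⟨fun x₀ => ⟨(MulEquiv.ofBijective _
    ⟨hinj x₀, CSpace.IsCocycle.toHom_surjective _ hcon hs x₀⟩).trans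
    FreeGroup.mulEquivIntOfUnique⟩, γ, hγ, hb⟩

lemma pi1_small (hc' : c ≤ 8) (hS : IsResolution e S)
    (hd : GridData e D (gap c)) (he1 : e < 1) :
    (∀ x₀, Nonempty (S.Pi1 x₀ ≃* Multiplicative ℤ)) ∧
      ∃ γ : S.Loop ⟨(0, 0), mem_origin hd⟩, RunsAlong (fun i => (γ.1.1 i : ℝ × ℝ))
        ![(0, 0), (11, 0), (11, 5), (0, 5), (0, 0)] ∧
        Function.Bijective (FreeGroup.lift fun _ : Unit => CSpace.Pi1.mk γ) := by
  have he := hd.nonneg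
  -- For `e < 1` only the columns without gap are passable, so the second component starts at `10`.
  obtain ⟨hk, hinj⟩ := pi1_of_two_components hS hd 10 (by norm_num) (by norm_num; linarith)
    (fun s hs => by
      rw [gap_of_ge_ten hc' (by simpa using hs)]
      norm_num
      exact he)
    (fun s h1 h2 => by
      have h2 : s < 10 := by simpa using h2
      rcases gap_cases hc' s with h | h | h | h | h
      · linarith
      · rw [h.2.2]
        norm_num
        linarith
      · rw [h.2.2]
        norm_num
        linarith
      · rw [h.2.2.2]
        norm_num
        linarith
      · linarith)
  have g0 : (gap c 0 : ℝ) ≤ 1 + e := by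
    rw [gap_of_le_one zero_le_one, Nat.cast_one]
    linarith
  have g11 : (gap c 11 : ℝ) ≤ 1 + e := by
    rw [gap_of_ge_ten hc' (by norm_num), Nat.cast_one]
    linarith
  refine infinite_cyclic_of_run hS hd hk hinj rfl rfl ?_
  have r1 := (HasRun.nil S (columnCocycle e D (gap c) leftCut) (mem_origin hd)).cons_vertical hS hd
    0 (by norm_num) (s := 0) (by simp) g0 (y := 5) (y' := 0) (by simp) rfl
  have r2 := r1.cons_top hS hd 0 11 (by norm_num) le_rfl (s := 11) (s' := 0) (by simp) rfl
  have r3 := r2.cons_vertical hS hd 11 le_rfl (s := 11) (by simp) g11 (y := 0) (y' := 5) (by simp)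
    rfl
  have r4 := r3.cons_bottom hS hd hk 0 11 (by norm_num) le_rfl (s := 0) (s' := 11) (by simp) rfl
    g0 g11
  convert r4 using 1
  rw [leftCut, leftCut, if_pos (by norm_num), if_neg (by norm_num)]
  simp

lemma pi1_large (hc : 4 < c) (hc' : c ≤ 8) (hS : IsResolution e S)
    (hd : GridData e D (gap c)) (he2 : 2 ≤ e) (he3 : e < 3) :
    (∀ x₀, Nonempty (S.Pi1 x₀ ≃* Multiplicative ℤ)) ∧
      ∃ γ : S.Loop ⟨(0, 0), mem_origin hd⟩, RunsAlong (fun i => (γ.1.1 i : ℝ × ℝ))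
        ![(0, 0), (4, 0), (4, 5), (0, 5), (0, 0)] ∧
        Function.Bijective (FreeGroup.lift fun _ : Unit => CSpace.Pi1.mk γ) := by
  have he := hd.nonneg
  have hc4 : (4 : ℝ) < c := by exact_mod_cast hc
  have g4 : ∀ s : ℝ, 4 ≤ s → (gap c s : ℝ) ≤ 1 + e := fun s hs => by
    rcases gap_cases hc' s with h | h | h | h | h
    · linarith
    · linarith
    · rw [h.2.2]
      norm_num
      linarith
    · rw [h.2.2.2]
      norm_num
      linarith
    · rw [h.2]
      norm_num
      linarith
  -- For `2 ≤ e < 3` the gaps over `B` and `C` can be crossed and only that over `A` cannot, so the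
  -- second component starts at `4`.
  obtain ⟨hk, hinj⟩ := pi1_of_two_components hS hd 4 (by norm_num) (by norm_num; linarith)
    (fun s hs => g4 s (by simpa using hs))
    (fun s h1 h2 => by
      rw [gap_of_mem_Ioo h1 (by simpa using h2)]
      norm_num
      linarith)
  have g0 : (gap c 0 : ℝ) ≤ 1 + e := by
    rw [gap_of_le_one zero_le_one, Nat.cast_one]
    linarith
  refine infinite_cyclic_of_run hS hd hk hinj rfl rfl ?_
  have r1 := (HasRun.nil S (columnCocycle e D (gap c) leftCut) (mem_origin hd)).cons_vertical hS hd
    0 (by norm_num) (s := 0) (by simp) g0 (y := 5) (y' := 0) (by simp) rfl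
  have r2 := r1.cons_top hS hd 0 4 (by norm_num) (by norm_num) (s := 4) (s' := 0) (by simp) rfl
  have r3 := r2.cons_vertical hS hd 4 (by norm_num) (s := 4) (by simp) (g4 4 le_rfl) (y := 0)
    (y' := 5) (by simp) rfl
  have r4 := r3.cons_bottom hS hd hk 0 4 (by norm_num) (by norm_num) (s := 0) (s' := 4) (by simp)
    rfl g0 (g4 4 le_rfl)
  convert r4 using 1
  rw [leftCut, leftCut, if_pos (by norm_num), if_neg (by norm_num)]
  simp

lemma pi1_medium (hc : 4 < c) (hc' : c ≤ 8) (hS : IsResolution e S)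
    (hd : GridData e D (gap c)) (he1 : 1 ≤ e) (he2 : e < 2) :
    (∀ x₀, Nonempty (S.Pi1 x₀ ≃* Monoid.Coprod (Multiplicative ℤ) (Multiplicative ℤ))) ∧
      ∃ γ δ : S.Loop ⟨(0, 0), mem_origin hd⟩, RunsAlong (fun i => (γ.1.1 i : ℝ × ℝ))
        ![(0, 0), (4, 0), (4, 5), (0, 5), (0, 0)] ∧
        RunsAlong (fun i => (δ.1.1 i : ℝ × ℝ))
          ![(0, 0), (11, 0), (11, 5), ((c : ℝ), 5), ((c : ℝ), 0), (0, 0)] ∧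
        Function.Bijective (FreeGroup.lift ![CSpace.Pi1.mk γ, CSpace.Pi1.mk δ]) := by
  have he := hd.nonneg
  have hc4 : (4 : ℝ) < c := by exact_mod_cast hc
  have hc8 : (c : ℝ) ≤ 8 := by exact_mod_cast hc'
  obtain ⟨hk, hinj⟩ := pi1_of_three_components hc hc' hS hd he1 he2
  have g0 : (gap c 0 : ℝ) ≤ 1 + e := by
    rw [gap_of_le_one zero_le_one, Nat.cast_one]
    linarith
  have g4 : ∀ s : ℝ, 4 ≤ s → s ≤ c → (gap c s : ℝ) ≤ 1 + e := fun s h h' => by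
    rw [gap_of_mem_Icc h h']
    norm_num
    linarith
  have g11 : (gap c 11 : ℝ) ≤ 1 + e := by
    rw [gap_of_ge_ten hc' (by norm_num), Nat.cast_one]
    linarith
  have hcon := hS.connected hd g0
  have r0 := HasRun.nil S (columnCocycle e D (gap c) doubleCut) (mem_origin hd)
  have r1 := r0.cons_vertical hS hd 0 (by norm_num) (s := 0) (by simp) g0 (y := 5) (y' := 0)
    (by simp) rfl
  have r2 := r1.cons_top hS hd 0 4 (by norm_num) (by norm_num) (s := 4) (s' := 0) (by simp) rfl
  have r3 := r2.cons_vertical hS hd 4 (by norm_num) (s := 4) (by simp) (g4 4 le_rfl hc4.le)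
    (y := 0) (y' := 5) (by simp) rfl
  have r4 := r3.cons_bottom hS hd hk 0 4 (by norm_num) (by norm_num) (s := 0) (s' := 4) (by simp)
    rfl g0 (g4 4 le_rfl hc4.le)
  -- The loop around `C` has two bottom edges: `0` to `11` contributes `(doubleCut 0)⁻¹ * doubleCut
  -- 11`, and `c` to `0` contributes `(doubleCut c)⁻¹ * doubleCut 0`. Their product is `FreeGroup.of
  -- 1`.
  have q1 := r0.cons_bottom hS hd hk 0 c (by omega) (by omega) (s := c) (s' := 0) (by simp) rfl
    (g4 c hc4.le le_rfl) g0
  have q2 := q1.cons_vertical hS hd c (by omega) (s := c) rfl (g4 c hc4.le le_rfl) (y := 5)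
    (y' := 0) (by simp) rfl
  have q3 := q2.cons_top hS hd c 11 (by omega) le_rfl (s := 11) (s' := c) (by simp) rfl
  have q4 := q3.cons_vertical hS hd 11 le_rfl (s := 11) (by simp) g11 (y := 0) (y' := 5) (by simp)
    rfl
  have q5 := q4.cons_bottom hS hd hk 0 11 (by norm_num) le_rfl (s := 0) (s' := 11) (by simp) rfl
    g0 g11
  have v0 : doubleCut 0 = (FreeGroup.of 0)⁻¹ := if_pos zero_le_one
  have v4 : ∀ s : ℝ, 4 ≤ s → s ≤ c → doubleCut s = 1 := fun s h h' => by
    rw [doubleCut, if_neg (by linarith), if_pos (by linarith)]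
  have v11 : doubleCut 11 = (FreeGroup.of 0)⁻¹ * FreeGroup.of 1 * FreeGroup.of 0 := by
    rw [doubleCut, if_neg (by norm_num), if_neg (by norm_num)]
  obtain ⟨γ, hγ, hvγ⟩ := r4.exists_loop (hk.isCocycle hS) (o := ⟨(0, 0), mem_origin hd⟩) rfl rfl
  obtain ⟨δ, hδ, hvδ⟩ := q5.exists_loop (hk.isCocycle hS) (o := ⟨(0, 0), mem_origin hd⟩) rfl rfl
  rw [v0, v4 4 le_rfl hc4.le] at hvγ
  rw [v0, v4 c hc4.le le_rfl, v11] at hvδ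
  obtain ⟨hb, hs⟩ := FreeGroup.lift_bijective_of_injective _ (hinj _)
    ![CSpace.Pi1.mk γ, CSpace.Pi1.mk δ] fun i => by
      fin_cases i
      · simpa using hvγ
      · simpa [mul_assoc] using hvδ
  exact ⟨fun x₀ => ⟨(MulEquiv.ofBijective _
    ⟨hinj x₀, CSpace.IsCocycle.toHom_surjective _ hcon hs x₀⟩).trans
    FreeGroup.finTwoEquivCoprod⟩, γ, δ, hγ, hδ, hb⟩

theorem pi1_columnRegion (hc : 4 < c) (hc' : c ≤ 8) {ε : ℝ≥0∞}
    (hd : GridData (min ε 100).toReal D (gap c)) :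
    (CSpace.resolution (columnRegion D (gap c)) ε).Connected ∧
      (∀ x₀ : columnRegion D (gap c),
        (ε < 1 → Nonempty ((CSpace.resolution (columnRegion D (gap c)) ε).Pi1 x₀ ≃*
          Multiplicative ℤ)) ∧
        (1 ≤ ε → ε < 2 → Nonempty ((CSpace.resolution (columnRegion D (gap c)) ε).Pi1 x₀ ≃*
          Monoid.Coprod (Multiplicative ℤ) (Multiplicative ℤ))) ∧
        (2 ≤ ε → ε < 3 → Nonempty ((CSpace.resolution (columnRegion D (gap c)) ε).Pi1 x₀ ≃*
          Multiplicative ℤ)) ∧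
        (3 ≤ ε → Subsingleton ((CSpace.resolution (columnRegion D (gap c)) ε).Pi1 x₀))) ∧
      ∃ o : columnRegion D (gap c), (o : ℝ × ℝ) = (0, 0) ∧
        (ε < 1 → ∃ γ : (CSpace.resolution (columnRegion D (gap c)) ε).Loop o,
          RunsAlong (fun i => (γ.1.1 i : ℝ × ℝ)) ![(0, 0), (11, 0), (11, 5), (0, 5), (0, 0)] ∧
          Function.Bijective (FreeGroup.lift fun _ : Unit => CSpace.Pi1.mk γ)) ∧
        (1 ≤ ε → ε < 2 → ∃ γ δ : (CSpace.resolution (columnRegion D (gap c)) ε).Loop o,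
          RunsAlong (fun i => (γ.1.1 i : ℝ × ℝ)) ![(0, 0), (4, 0), (4, 5), (0, 5), (0, 0)] ∧
          RunsAlong (fun i => (δ.1.1 i : ℝ × ℝ))
            ![(0, 0), (11, 0), (11, 5), ((c : ℝ), 5), ((c : ℝ), 0), (0, 0)] ∧
          Function.Bijective (FreeGroup.lift ![CSpace.Pi1.mk γ, CSpace.Pi1.mk δ])) ∧
        (2 ≤ ε → ε < 3 → ∃ γ : (CSpace.resolution (columnRegion D (gap c)) ε).Loop o,
          RunsAlong (fun i => (γ.1.1 i : ℝ × ℝ)) ![(0, 0), (4, 0), (4, 5), (0, 5), (0, 0)] ∧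
          Function.Bijective (FreeGroup.lift fun _ : Unit => CSpace.Pi1.mk γ)) := by
  have hS := isResolution_resolution D (gap c) ε
  have l1 : (1 : ℝ) ≤ (min ε 100).toReal ↔ 1 ≤ ε := by
    exact_mod_cast natCast_le_toReal_min_iff 1 (by norm_num)
  have l2 : (2 : ℝ) ≤ (min ε 100).toReal ↔ 2 ≤ ε := by
    exact_mod_cast natCast_le_toReal_min_iff 2 (by norm_num)
  have l3 : (3 : ℝ) ≤ (min ε 100).toReal ↔ 3 ≤ ε := by
    exact_mod_cast natCast_le_toReal_min_iff 3 (by norm_num)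
  have k1 : (min ε 100).toReal < 1 ↔ ε < 1 := by rw [← not_le, l1, not_le]
  have k2 : (min ε 100).toReal < 2 ↔ ε < 2 := by rw [← not_le, l2, not_le]
  have k3 : (min ε 100).toReal < 3 ↔ ε < 3 := by rw [← not_le, l3, not_le]
  refine ⟨hS.connected hd ?_, fun x₀ => ⟨fun h => ?_, fun h h' => ?_, fun h h' => ?_,
    fun h => ?_⟩, ⟨(0, 0), mem_origin hd⟩, rfl, fun h => ?_, fun h h' => ?_, fun h h' => ?_⟩
  · rw [gap_of_le_one zero_le_one, Nat.cast_one]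
    linarith [hd.nonneg]
  · exact (pi1_small hc' hS hd (k1.2 h)).1 x₀
  · exact (pi1_medium hc hc' hS hd (l1.2 h) (k2.2 h')).1 x₀
  · exact (pi1_large hc hc' hS hd (l2.2 h) (k3.2 h')).1 x₀
  · exact pi1_of_one_component hc' hS hd (l3.2 h) x₀
  · exact (pi1_small hc' hS hd (k1.2 h)).2
  · exact (pi1_medium hc hc' hS hd (l1.2 h) (k2.2 h')).2
  · exact (pi1_large hc hc' hS hd (l2.2 h) (k3.2 h')).2

lemma finite_digitalModel (c : ℝ) {k : ℕ} (hk : 0 < k) :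
    (digitalModel (planarRegion c) k).Finite := by
  have hk' : (0 : ℝ) < k := Nat.cast_pos.2 hk
  refine ((Set.finite_Icc ((0 : ℤ), (0 : ℤ)) (11 * k, 5 * k)).image
    fun q : ℤ × ℤ => ((q.1 : ℝ) / k, (q.2 : ℝ) / k)).subset ?_
  rintro _ ⟨⟨⟨⟨h1, h2⟩, h3, h4⟩, -⟩, i, j, rfl⟩
  refine ⟨(i, j), ⟨⟨?_, ?_⟩, ?_, ?_⟩, rfl⟩
  · have := (le_div_iff₀ hk').1 h1
    rw [zero_mul] at this
    exact_mod_cast this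
  · have := (le_div_iff₀ hk').1 h3
    rw [zero_mul] at this
    exact_mod_cast this
  · have := (div_le_iff₀ hk').1 h2
    exact_mod_cast this
  · have := (div_le_iff₀ hk').1 h4
    exact_mod_cast this

lemma eq_of_abs_lt_one_div {k : ℕ} (hk : 0 < k) {i j : ℤ}
    (h : |(i : ℝ) / k - (j : ℝ) / k| < 1 / k) : i = j := by
  have hk' : (0 : ℝ) < k := Nat.cast_pos.2 hk
  rw [← sub_div, abs_div, abs_of_pos hk', div_lt_div_iff_of_pos_right hk'] at h
  have h' : |i - j| < 1 := by exact_mod_cast h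
  rw [Int.abs_lt_one_iff] at h'
  omega

lemma subsingleton_of_linked (X : Set (ℝ × ℝ)) {k : ℕ} (hk : 0 < k) {ε : ℝ≥0∞}
    (hε : ε < (k : ℝ≥0∞)⁻¹) {ξ : Set (digitalModel X k)}
    (hξ : (CSpace.resolution (digitalModel X k) ε).Linked ξ) : ξ.Subsingleton := by
  rintro ⟨_, hx, i, j, rfl⟩ h1 ⟨_, hy, i', j', rfl⟩ h2
  have h := (Metric.ediam_le_iff.1 hξ.2 _ h1 _ h2).trans_lt hε
  have e1 : (k : ℝ≥0∞)⁻¹ = ENNReal.ofReal (1 / k) := by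
    rw [one_div, ENNReal.ofReal_inv_of_pos (Nat.cast_pos.2 hk), ENNReal.ofReal_natCast]
  have hp : 0 < 1 / (k : ℝ) := by
    have : (0 : ℝ) < k := Nat.cast_pos.2 hk
    positivity
  rw [Subtype.edist_eq, Prod.edist_eq, max_lt_iff, edist_dist, edist_dist, Real.dist_eq,
    Real.dist_eq, e1, ENNReal.ofReal_lt_ofReal_iff hp, ENNReal.ofReal_lt_ofReal_iff hp] at h
  obtain rfl := eq_of_abs_lt_one_div hk h.1
  obtain rfl := eq_of_abs_lt_one_div hk h.2
  rfl

end Final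

theorem mainTheorem10 (c : ℕ) (hc : 4 < c) (hc' : c ≤ 8) :
    (∀ (Y : Set (ℝ × ℝ)) (ε : ℝ≥0∞),
      ((Y = planarRegion c ∧ 0 < ε) ∨
        (∃ k : ℕ, 0 < k ∧ Y = digitalModel (planarRegion c) k ∧ (k : ℝ≥0∞)⁻¹ ≤ ε)) →
      (CSpace.resolution Y ε).Connected ∧
      (∀ x₀ : Y,
        (ε < 1 → Nonempty ((CSpace.resolution Y ε).Pi1 x₀ ≃* Multiplicative ℤ)) ∧
        (1 ≤ ε → ε < 2 → Nonempty ((CSpace.resolution Y ε).Pi1 x₀ ≃*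
          Monoid.Coprod (Multiplicative ℤ) (Multiplicative ℤ))) ∧
        (2 ≤ ε → ε < 3 → Nonempty ((CSpace.resolution Y ε).Pi1 x₀ ≃* Multiplicative ℤ)) ∧
        (3 ≤ ε → Subsingleton ((CSpace.resolution Y ε).Pi1 x₀))) ∧
      ∃ o : Y, (o : ℝ × ℝ) = (0, 0) ∧
        (ε < 1 → ∃ γ : (CSpace.resolution Y ε).Loop o,
          RunsAlong (fun i => (γ.1.1 i : ℝ × ℝ)) ![(0, 0), (11, 0), (11, 5), (0, 5), (0, 0)] ∧
          Function.Bijective (FreeGroup.lift fun _ : Unit => CSpace.Pi1.mk γ)) ∧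
        (1 ≤ ε → ε < 2 → ∃ γ δ : (CSpace.resolution Y ε).Loop o,
          RunsAlong (fun i => (γ.1.1 i : ℝ × ℝ)) ![(0, 0), (4, 0), (4, 5), (0, 5), (0, 0)] ∧
          RunsAlong (fun i => (δ.1.1 i : ℝ × ℝ))
            ![(0, 0), (11, 0), (11, 5), ((c : ℝ), 5), ((c : ℝ), 0), (0, 0)] ∧
          Function.Bijective (FreeGroup.lift ![CSpace.Pi1.mk γ, CSpace.Pi1.mk δ])) ∧
        (2 ≤ ε → ε < 3 → ∃ γ : (CSpace.resolution Y ε).Loop o,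
          RunsAlong (fun i => (γ.1.1 i : ℝ × ℝ)) ![(0, 0), (4, 0), (4, 5), (0, 5), (0, 0)] ∧
          Function.Bijective (FreeGroup.lift fun _ : Unit => CSpace.Pi1.mk γ))) ∧
    ∀ k : ℕ, 0 < k → (digitalModel (planarRegion c) k).Finite ∧
      ∀ ε : ℝ≥0∞, ε < (k : ℝ≥0∞)⁻¹ → ∀ ξ : Set (digitalModel (planarRegion c) k),
        (CSpace.resolution (digitalModel (planarRegion c) k) ε).Linked ξ → ξ.Subsingleton := by
  refine ⟨?_, fun k hk => ⟨finite_digitalModel c hk,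
    fun ε hε ξ hξ => subsingleton_of_linked _ hk hε hξ⟩⟩
  rintro Y ε (⟨rfl, hε⟩ | ⟨k, hk, rfl, hε⟩)
  · rw [planarRegion_eq hc hc']
    exact pi1_columnRegion hc hc' (gridData_univ hε (one_le_gap c) (gap_le_five c))
  · rw [digitalModel_eq hc hc']
    exact pi1_columnRegion hc hc' (gridData_lattice hk hε (one_le_gap c) (gap_le_five c))
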